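/- Let $X,Y,Z$ be random variables with finite alphabets and joint distribution $P_{XYZ}$; logarithms are natural. For a discrete random variable $U$, jointly distributed with $(X,Y,Z)$, and $1<\alpha<\infty$, the conditional $\alpha$-leakage is $$\mathcal L_\alpha(U\to Y|Z)=\frac{\alpha}{\alpha-1}\log\frac{\max_{P_{\hat U|Y,Z}}\mathbb E\big[P_{\hat U|Y,Z}(U|Y,Z)^{\frac{\alpha-1}{\alpha}}\big]}{\max_{P_{\hat U|Z}}\mathbb E\big[P_{\hat U|Z}(U|Z)^{\frac{\alpha-1}{\alpha}}\big]},$$ and for $\alpha=1$ and $\alpha=\infty$ it is defined by the limits $\alpha\downarrow1$ and $\alpha\to\infty$. For $\alpha\in[1,\infty]$ the conditional maximal $\alpha$-leakage is $$\mathcal L^{\max}_\alpha(X\to Y|Z)=\sup_{U:\,U-(X,Z)-Y}\mathcal L_\alpha(U\to Y|Z),$$ where the supremum is over all discrete random variables $U$, with arbitrary alphabet, such that $U$ and $Y$ are conditionally independent given $(X,Z)$. For $z$ with $P_Z(z)>0$ and a distribution $P_{\tilde X}\ll P_{X|Z=z}$ put, for $1<\alpha<\infty$, $$I^{S}_\alpha(\tilde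 X;Y|Z=z)=\frac{\alpha}{\alpha-1}\log\sum_y\Big(\sum_x P_{\tilde X}(x)P_{Y|X,Z}(y|x,z)^\alpha\Big)^{1/\alpha},$$ $$I^{A}_\alpha(\tilde X;Y|Z=z)=\frac{\alpha}{\alpha-1}\log\sum_y\Big(\frac{\sum_x P_{\tilde X}(x)^\alpha P_{Y|X,Z}(y|x,z)^\alpha}{\sum_x P_{\tilde X}(x)^\alpha}\Big)^{1/\alpha},$$ and define both for $\alpha=\infty$ by the limit $\alpha\to\infty$. Theorem. All the limits above exist and are finite. For every $\alpha\in(1,\infty]$, $$\mathcal L^{\max}_\alpha(X\to Y|Z)=\sup_{z\in\operatorname{supp}(Z)}\ \sup_{P_{\tilde X}\ll P_{X|Z=z}} I^{S}_\alpha(\tilde X;Y|Z=z)=\sup_{z\in\operatorname{supp}(Z)}\ \sup_{P_{\tilde X}\ll P_{X|Z=z}} I^{A}_\alpha(\tilde X;Y|Z=z),$$ that is, the conditional maximal $\alpha$-leakage is the largest Arimoto capacity (with inputs restricted to the support of $P_{X|Z=z}$) of the channels $P_{Y|X,Z=z}$, over the channel states $z\in\operatorname{supp}(Z)$. For $\alpha=1$,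 $\mathcal L^{\max}_1(X\to Y|Z)=I(X;Y|Z)$, the conditional Shannon mutual information. -/

import Mathlib

open Filter Topology
open scoped ENNReal

universe w u₁ u₂ u₃

/-- Extension to the closed range `[1, ∞]` of orders of a quantity given for real orders `a > 1`:
the right limit at `1`, the limit `a → ∞` at `∞`, the quantity itself in between. -/
noncomputable def orderExtension (f : ℝ → ℝ) (α : ℝ≥0∞) : ℝ :=
  if α = 1 then limUnder (𝓝[>] (1 : ℝ)) f
  else if α = ∞ then limUnder atTop f
  else f α.toReal

section Leakage

/-- Conditional `a`-leakage `L_a(A → Y | Z)` of a joint law of `(A, Y, Z)`, for real `a > 1`: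
`a/(a-1) * log` of the ratio of the largest values of `E[P_{Â|Y,Z}(A|Y,Z)^((a-1)/a)]` and
`E[P_{Â|Z}(A|Z)^((a-1)/a)]` over all randomized estimators `Â` of `A`. -/
noncomputable def condAlphaLeakageReal {A Y Z : Type*} (J : PMF (A × Y × Z)) (a : ℝ) : ℝ :=
  a / (a - 1) * Real.log
    ((⨆ q : Y × Z → PMF A, ∑' w : A × Y × Z, J w * (q (w.2.1, w.2.2) w.1) ^ ((a - 1) / a)) /
      (⨆ q : Z → PMF A, ∑' w : A × Y × Z, J w * (q w.2.2 w.1) ^ ((a - 1) / a))).toReal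

/-- Conditional `α`-leakage for `α ∈ [1, ∞]`. -/
noncomputable def condAlphaLeakage {A Y Z : Type*} (J : PMF (A × Y × Z)) (α : ℝ≥0∞) : ℝ :=
  orderExtension (condAlphaLeakageReal J) α

/-- The marginal law of `Z`. -/
noncomputable def margZ {X Y Z : Type*} (P : PMF (X × Y × Z)) : PMF Z :=
  P.map fun w => w.2.2

/-- The marginal law of `(X, Z)`. -/
noncomputable def margXZ {X Y Z : Type*} (P : PMF (X × Y × Z)) : PMF (X × Z) :=
  P.map fun w => (w.1, w.2.2)

/-- The marginal law of `(Y, Z)`. -/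
noncomputable def margYZ {X Y Z : Type*} (P : PMF (X × Y × Z)) : PMF (Y × Z) :=
  P.map fun w => w.2

/-- The marginal law of `(U, Y, Z)`. -/
noncomputable def margUYZ {A X Y Z : Type*} (J : PMF (A × X × Y × Z)) : PMF (A × Y × Z) :=
  J.map fun w => (w.1, w.2.2.1, w.2.2.2)

/-- The marginal law of `(U, X, Z)`. -/
noncomputable def margUXZ {A X Y Z : Type*} (J : PMF (A × X × Y × Z)) : PMF (A × X × Z) :=
  J.map fun w => (w.1, w.2.1, w.2.2.2)

/-- `J` is a joint law of `(U, X, Y, Z)` whose `(X, Y, Z)`-marginal is `P` and under which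
`U - (X, Z) - Y` is a Markov chain: `P(u,x,y,z) P(x,z) = P(u,x,z) P(x,y,z)`, that is,
`P(u,x,y|z) = P(x|z) P(u|x,z) P(y|x,z)` for every `z` of positive probability. -/
structure IsMarkovExtension {A X Y Z : Type*} (J : PMF (A × X × Y × Z)) (P : PMF (X × Y × Z)) :
    Prop where
  marginal : J.map Prod.snd = P
  markov : ∀ (u : A) (x : X) (y : Y) (z : Z),
    J (u, x, y, z) * margXZ P (x, z) = margUXZ J (u, x, z) * P (x, y, z)

/-- Conditional maximal `α`-leakage from `X` to `Y` given `Z`: the supremum of the conditional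
`α`-leakage from `U` to `Y` given `Z` over all discrete random variables `U`, on an arbitrary
alphabet `A`, for which `U - (X, Z) - Y`. -/
noncomputable def condMaxAlphaLeakage.{v, v₁, v₂, v₃} {X : Type v₁} {Y : Type v₂} {Z : Type v₃}
    (P : PMF (X × Y × Z)) (α : ℝ≥0∞) : EReal :=
  ⨆ (A : Type v) (J : PMF (A × X × Y × Z)) (_ : IsMarkovExtension J P),
    ((condAlphaLeakage (margUYZ J) α : ℝ) : EReal)

/-- `P(x|z)`. -/
noncomputable def condX {X Y Z : Type*} (P : PMF (X × Y × Z)) (z : Z) (x : X) : ℝ≥0∞ :=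
  margXZ P (x, z) / margZ P z

/-- The channel `P(y|x,z)` in state `z` (with value `0` where `P(x,z) = 0`). -/
noncomputable def condY {X Y Z : Type*} (P : PMF (X × Y × Z)) (z : Z) (x : X) (y : Y) : ℝ≥0∞ :=
  P (x, y, z) / margXZ P (x, z)

/-- Absolute continuity `Q ≪ P_{X|Z=z}`. -/
def AbsContCondX {X Y Z : Type*} (Q : PMF X) (P : PMF (X × Y × Z)) (z : Z) : Prop :=
  ∀ x, condX P z x = 0 → Q x = 0

/-- Event-conditional Sibson mutual information `I_a^S(X̃; Y | Z = z)` for real `a > 1`, where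
`X̃` has law `Q` and `Y` is produced from it by the channel `P(y|x,z)`. -/
noncomputable def eventSibsonReal {X Y Z : Type*} [Fintype X] [Fintype Y] (P : PMF (X × Y × Z))
    (z : Z) (Q : PMF X) (a : ℝ) : ℝ :=
  a / (a - 1) * Real.log (∑ y, (∑ x, Q x * condY P z x y ^ a) ^ (1 / a)).toReal

/-- Event-conditional Sibson mutual information for `α ∈ [1, ∞]`. -/
noncomputable def eventSibson {X Y Z : Type*} [Fintype X] [Fintype Y] (P : PMF (X × Y × Z))
    (z : Z) (Q : PMF X) (α : ℝ≥0∞) : ℝ :=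
  orderExtension (eventSibsonReal P z Q) α

/-- Event-conditional Arimoto mutual information `I_a^A(X̃; Y | Z = z)` for real `a > 1`, where
`X̃` has law `Q` and `Y` is produced from it by the channel `P(y|x,z)`. -/
noncomputable def eventArimotoReal {X Y Z : Type*} [Fintype X] [Fintype Y] (P : PMF (X × Y × Z))
    (z : Z) (Q : PMF X) (a : ℝ) : ℝ :=
  a / (a - 1) * Real.log
    (∑ y, ((∑ x, Q x ^ a * condY P z x y ^ a) / (∑ x, Q x ^ a)) ^ (1 / a)).toReal

/-- Event-conditional Arimoto mutual information for `α ∈ [1, ∞]`. -/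
noncomputable def eventArimoto {X Y Z : Type*} [Fintype X] [Fintype Y] (P : PMF (X × Y × Z))
    (z : Z) (Q : PMF X) (α : ℝ≥0∞) : ℝ :=
  orderExtension (eventArimotoReal P z Q) α

/-- Conditional Shannon mutual information `I(X; Y | Z)` (in nats). -/
noncomputable def condShannonMI {X Y Z : Type*} [Fintype X] [Fintype Y] [Fintype Z]
    (P : PMF (X × Y × Z)) : ℝ :=
  ∑ x, ∑ y, ∑ z, (P (x, y, z)).toReal *
    Real.log (((P (x, y, z)).toReal * (margZ P z).toReal) /
      ((margXZ P (x, z)).toReal * (margYZ P (y, z)).toReal))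

end Leakage

/-! For a fixed nonnegative family `f`, Hölder's inequality shows that the maximum of `∑ f
q^((a-1)/a)` over laws `q` is the `ℓ^a` norm of `f`, attained at `q ∝ f^a`. The leakage of `U` is
therefore `a/(a-1)` times the logarithm of `N/D`, where `N` sums the norms of `P(·,y,z)` over
`(y,z)` and `D` those of `P(·,z)` over `z` (`condAlphaLeakageReal_eq`).

Upper bound. `N/D` is at most the largest of the ratios belonging to single states `z`. In one
state, take `Q(x) ∝ ∑_u P(u,z)^(a-1) P(u,x,z)`. The power mean inequality, applied to `P(u,y,z) =
∑_x P(u,x,z) P(y|x,z)`, bounds the ratio by the Sibson sum at `Q`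
(`IsMarkovExtension.exists_sibsonSum_ge`).

Lower bound. Splitting the letter `x` in state `z` uniformly into `n(x,z)` letters puts weights
`n^(1-a)` into the norms. A common factor of the weights cancels in `N/D`, so all nonnegative
weights are reached in the limit. Weights `Q(x)/P(x,z)^a` in one state and zero in the others yield
the Sibson sum (`exists_tendsto_sibson`). The tilt `Q ↦ Q^a / ∑ Q^a` is invertible, keeps the
support, and turns Arimoto into Sibson.

Order `∞`. Norms become suprema. The supremum over `U` is never interchanged with the limit: `∑_y
max_x P(y|x,z)` bounds the Sibson sum uniformly in `Q` and `a`, shattering at order `∞` approaches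
it, and the uniform law on the support attains it.

Order `1`. `N` and `D` tend to `1`, so the leakage tends to the limit of `(N - D)/(a - 1)`. As `U`
may have infinite entropy, `N` and `D` are not expanded separately; the cross terms `∑_u
P(u,z)^(a-1) P(u,y,z)` inserted between them make the infinite sums dominated
(`tendsto_leakage_term`). The limit is `I(U;Y|Z)`, at most `I(X;Y|Z)` by convexity of `t log t`,
with equality at `U = X`. -/

set_option linter.unusedSectionVars false

/-! ### Optimal estimators and the closed form of the leakage. -/

section Estimators

/-- Hölder's inequality for infinite sums in `ℝ≥0∞`. -/
theorem ennreal_tsum_mul_le_Lp_mul_Lq {ι : Type*} (f g : ι → ℝ≥0∞) {p q : ℝ}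
    (hpq : p.HolderConjugate q) :
    ∑' i, f i * g i ≤ (∑' i, f i ^ p) ^ (1 / p) * (∑' i, g i ^ q) ^ (1 / q) := by
  rw [ENNReal.tsum_eq_iSup_sum]
  refine iSup_le fun s => (ENNReal.inner_le_Lp_mul_Lq s f g hpq).trans ?_
  have hp : 0 ≤ 1 / p := one_div_nonneg.2 hpq.nonneg
  have hq : 0 ≤ 1 / q := one_div_nonneg.2 hpq.symm.nonneg
  gcongr
  · exact ENNReal.sum_le_tsum s
  · exact ENNReal.sum_le_tsum s

theorem tsum_rpow_le_one {A : Type*} {f : A → ℝ≥0∞} (hf : ∑' u, f u ≤ 1) {a : ℝ} (ha : 1 ≤ a) :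
    ∑' u, f u ^ a ≤ 1 :=
  (ENNReal.tsum_le_tsum fun u =>
    ENNReal.rpow_le_self_of_le_one ((ENNReal.le_tsum u).trans hf) ha).trans hf

/-- Hölder with exponents `a` and `a/(a-1)`: the power on `q` is the one whose dual norm is the
total mass of `q`, namely one. -/
theorem tsum_mul_rpow_le {A : Type*} (f : A → ℝ≥0∞) (q : PMF A) {a : ℝ} (ha : 1 < a) :
    ∑' u, f u * q u ^ ((a - 1) / a) ≤ (∑' u, f u ^ a) ^ (1 / a) := by
  have h := ennreal_tsum_mul_le_Lp_mul_Lq f (fun u => q u ^ ((a - 1) / a))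
    (Real.HolderConjugate.conjExponent ha)
  refine h.trans (le_of_eq ?_)
  have h1 : ∀ u, (q u ^ ((a - 1) / a)) ^ a.conjExponent = q u := by
    intro u
    rw [← ENNReal.rpow_mul, Real.conjExponent]
    have h0 : a ≠ 0 := by linarith
    have h2 : a - 1 ≠ 0 := by linarith
    rw [div_mul_div_cancel₀ h0, div_self h2, ENNReal.rpow_one]
  simp only [h1, q.tsum_coe, ENNReal.one_rpow, mul_one]

/-- Equality case of Hölder: `q` proportional to `f^a`, or any law when `f` vanishes. -/
theorem exists_pmf_tsum_mul_rpow_eq {A : Type*} [Nonempty A] {f : A → ℝ≥0∞}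
    (hf : ∑' u, f u ≤ 1) {a : ℝ} (ha : 1 < a) :
    ∃ q : PMF A, ∑' u, f u * q u ^ ((a - 1) / a) = (∑' u, f u ^ a) ^ (1 / a) := by
  have ha0 : 0 < a := by linarith
  set S := ∑' u, f u ^ a with hS
  have hSt : S ≠ ∞ := ((tsum_rpow_le_one hf ha.le).trans_lt ENNReal.one_lt_top).ne
  by_cases hS0 : S = 0
  · refine ⟨PMF.pure (Classical.arbitrary A), ?_⟩
    have h0 : ∀ u, f u = 0 := by
      intro u
      have := ENNReal.tsum_eq_zero.1 hS0 u
      simpa [ENNReal.rpow_eq_zero_iff, ha0, ha0.not_gt] using this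
    simp [h0, hS0, ha0]
  · have hfin : ∀ u, f u ≠ ∞ := fun u =>
      (((ENNReal.le_tsum u).trans hf).trans_lt ENNReal.one_lt_top).ne
    refine ⟨PMF.normalize (fun u => f u ^ a) hS0 hSt, ?_⟩
    have h1 : ∀ u, f u * (PMF.normalize (fun u => f u ^ a) hS0 hSt) u ^ ((a - 1) / a)
        = f u ^ a * S⁻¹ ^ ((a - 1) / a) := by
      intro u
      have hs : 0 ≤ (a - 1) / a := div_nonneg (by linarith) ha0.le
      rw [PMF.normalize_apply, ENNReal.mul_rpow_of_nonneg _ _ hs, ← ENNReal.rpow_mul,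
        mul_div_cancel₀ _ ha0.ne', ← mul_assoc]
      congr 1
      by_cases hu : f u = 0
      · simp [hu, ha0]
      · conv_lhs => rw [← ENNReal.rpow_one (f u), ← ENNReal.rpow_mul, one_mul,
          ← ENNReal.rpow_add _ _ hu (hfin u)]
        congr 1; ring
    simp only [h1]
    rw [ENNReal.tsum_mul_right, ← hS, ENNReal.inv_rpow, ← ENNReal.rpow_neg]
    conv_lhs => rw [← ENNReal.rpow_one S, ← ENNReal.rpow_mul, one_mul,
      ← ENNReal.rpow_add _ _ hS0 hSt]
    congr 1
    field_simp
    ring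

/-- The law `q i` is chosen freely for each observation `i`, so the maximisation splits over the
observations. -/
theorem iSup_estimator_eq {ι A : Type*} [Fintype ι] [Nonempty A] {f : ι → A → ℝ≥0∞}
    (hf : ∀ i, ∑' u, f i u ≤ 1) {a : ℝ} (ha : 1 < a) :
    ⨆ q : ι → PMF A, ∑ i, ∑' u, f i u * q i u ^ ((a - 1) / a)
      = ∑ i, (∑' u, f i u ^ a) ^ (1 / a) := by
  apply le_antisymm
  · exact iSup_le fun q => Finset.sum_le_sum fun i _ => tsum_mul_rpow_le (f i) (q i) ha
  · choose q hq using fun i => exists_pmf_tsum_mul_rpow_eq (hf i) ha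
    refine le_trans (le_of_eq ?_) (le_iSup _ q)
    exact Finset.sum_congr rfl fun i _ => (hq i).symm

theorem PMF.nonempty_type {A : Type*} (J : PMF A) : Nonempty A := J.support_nonempty.to_type

theorem tsum_triple {A Y Z : Type*} [Fintype Y] [Fintype Z] (g : A × Y × Z → ℝ≥0∞) :
    ∑' w, g w = ∑ i : Y × Z, ∑' u, g (u, i) := by
  rw [ENNReal.tsum_prod', ENNReal.tsum_comm, tsum_fintype]

theorem tsum_fst_le_one {A Y Z : Type*} [Fintype Y] [Fintype Z] (J : PMF (A × Y × Z)) (z : Z) :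
    ∑' u, ∑ y, J (u, y, z) ≤ 1 := by
  rw [← J.tsum_coe, tsum_triple, Fintype.sum_prod_type, Finset.sum_comm,
    Summable.tsum_finsetSum fun _ _ => ENNReal.summable]
  exact Finset.single_le_sum (f := fun z => ∑ y, ∑' u, J (u, y, z)) (fun _ _ => zero_le)
    (Finset.mem_univ z)

theorem tsum_left_le_one {A I : Type*} (J : PMF (A × I)) (i : I) :
    ∑' u, J (u, i) ≤ 1 := by
  rw [← J.tsum_coe, ENNReal.tsum_prod']
  exact ENNReal.tsum_le_tsum fun u => ENNReal.le_tsum i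

/-- The conditional `a`-leakage as a ratio of sums of `ℓ^a` norms. -/
theorem condAlphaLeakageReal_eq_ennreal {A Y Z : Type*} [Fintype Y] [Fintype Z]
    (J : PMF (A × Y × Z)) {a : ℝ} (ha : 1 < a) :
    condAlphaLeakageReal J a = a / (a - 1) * Real.log
      ((∑ i : Y × Z, (∑' u, J (u, i) ^ a) ^ (1 / a)) /
        (∑ z, (∑' u, (∑ y, J (u, y, z)) ^ a) ^ (1 / a))).toReal := by
  obtain ⟨⟨u₀, -⟩⟩ := J.nonempty_type
  have : Nonempty A := ⟨u₀⟩
  unfold condAlphaLeakageReal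
  rw [← iSup_estimator_eq (f := fun (i : Y × Z) u => J (u, i)) (tsum_left_le_one J) ha,
    ← iSup_estimator_eq (f := fun z u => ∑ y, J (u, y, z)) (tsum_fst_le_one J) ha]
  congr 6
  · ext q
    exact tsum_triple _
  · ext q
    -- This estimator does not see `y`, so the mass is summed over `y` before the norm is taken.
    rw [tsum_triple, Fintype.sum_prod_type, Finset.sum_comm]
    refine Finset.sum_congr rfl fun z _ => ?_
    rw [← Summable.tsum_finsetSum fun _ _ => ENNReal.summable]
    exact tsum_congr fun u => by simp only [Finset.sum_mul]

/-- Real-valued form of `condAlphaLeakageReal_eq_ennreal`. -/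
theorem condAlphaLeakageReal_eq {A Y Z : Type*} [Fintype Y] [Fintype Z]
    (J : PMF (A × Y × Z)) {a : ℝ} (ha : 1 < a) :
    condAlphaLeakageReal J a = a / (a - 1) * Real.log
      ((∑ i : Y × Z, (∑' u, (J (u, i)).toReal ^ a) ^ (1 / a)) /
        (∑ z, (∑' u, (∑ y, (J (u, y, z)).toReal) ^ a) ^ (1 / a))) := by
  have ha0 : 0 < a := by linarith
  have key : ∀ f : A → ℝ≥0∞, ∑' u, f u ≤ 1 →
      (∑' u, f u ^ a) ^ (1 / a) ≠ ∞ ∧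
      ((∑' u, f u ^ a) ^ (1 / a)).toReal = (∑' u, (f u).toReal ^ a) ^ (1 / a) := by
    intro f hf
    have h1 := tsum_rpow_le_one hf ha.le
    have h2 : ∑' u, f u ^ a ≠ ∞ := (h1.trans_lt ENNReal.one_lt_top).ne
    refine ⟨ENNReal.rpow_ne_top_of_nonneg (by positivity) h2, ?_⟩
    rw [← ENNReal.toReal_rpow, ENNReal.tsum_toReal_eq fun u => ENNReal.ne_top_of_tsum_ne_top h2 u]
    simp only [ENNReal.toReal_rpow]
  rw [condAlphaLeakageReal_eq_ennreal J ha, ENNReal.toReal_div,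
    ENNReal.toReal_sum fun i _ => (key _ (tsum_left_le_one J i)).1,
    ENNReal.toReal_sum fun z _ => (key _ (tsum_fst_le_one J z)).1]
  congr 3
  · exact Finset.sum_congr rfl fun i _ => (key _ (tsum_left_le_one J i)).2
  · refine Finset.sum_congr rfl fun z _ => ?_
    rw [(key _ (tsum_fst_le_one J z)).2]
    congr 1
    refine tsum_congr fun u => ?_
    rw [ENNReal.toReal_sum fun y _ => PMF.apply_ne_top J _]

end Estimators

/-! ### Limits of `ℓ^a` norms and difference quotients as `a → ∞` and `a ↓ 1`. -/

section Limits

theorem summable_rpow_of_le_one {A : Type*} {f : A → ℝ} (h0 : ∀ u, 0 ≤ f u) (h1 : ∀ u, f u ≤ 1)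
    (hf : Summable f) {a : ℝ} (ha : 1 ≤ a) : Summable fun u => f u ^ a :=
  hf.of_nonneg_of_le (fun u => Real.rpow_nonneg (h0 u) a)
    fun u => Real.rpow_le_self_of_le_one (h0 u) (h1 u) ha

/-- The `ℓ^a` norm of a summable family converges to its supremum as `a → ∞`. -/
theorem tendsto_tsum_rpow_atTop {A : Type*} {f : A → ℝ} (h0 : ∀ u, 0 ≤ f u) (h1 : ∀ u, f u ≤ 1)
    (hf : Summable f) :
    Tendsto (fun a : ℝ => (∑' u, f u ^ a) ^ (1 / a)) atTop (𝓝 (⨆ u, f u)) := by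
  have hbdd : BddAbove (Set.range f) := ⟨1, by rintro _ ⟨u, rfl⟩; exact h1 u⟩
  by_cases hM : ∃ u, f u ≠ 0
  · obtain ⟨u₀, hu₀⟩ := hM
    set M := ⨆ u, f u with hMdef
    have hle : ∀ u, f u ≤ M := fun u => le_ciSup hbdd u
    have hMpos : 0 < M := (lt_of_le_of_ne (h0 u₀) hu₀.symm).trans_le (hle u₀)
    set S := ∑' u, f u with hS
    have hSpos : 0 < S := hf.tsum_pos h0 u₀ (lt_of_le_of_ne (h0 u₀) hu₀.symm)
    have hinv : Tendsto (fun a : ℝ => 1 / a) atTop (𝓝 0) := by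
      simpa using tendsto_inv_atTop_zero (𝕜 := ℝ)
    -- The alphabet may be infinite, so the upper squeeze uses the total mass instead of a
    -- cardinality: `∑ f^a ≤ M^(a-1) S`.
    have hup : Tendsto (fun a : ℝ => M * (S / M) ^ (1 / a)) atTop (𝓝 M) := by
      have : Tendsto (fun a : ℝ => (S / M) ^ (1 / a)) atTop (𝓝 ((S / M) ^ (0 : ℝ))) :=
        tendsto_const_nhds.rpow hinv (Or.inl (div_pos hSpos hMpos).ne')
      simpa using this.const_mul M
    refine tendsto_of_tendsto_of_tendsto_of_le_of_le' tendsto_const_nhds hup ?_ ?_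
    · filter_upwards [eventually_ge_atTop 1] with a ha
      have ha0 : 0 < a := by linarith
      have : Nonempty A := ⟨u₀⟩
      refine ciSup_le fun u => ?_
      calc f u = (f u ^ a) ^ (1 / a) := by
            rw [← Real.rpow_mul (h0 u), mul_one_div_cancel ha0.ne', Real.rpow_one]
        _ ≤ _ := by
            refine Real.rpow_le_rpow (Real.rpow_nonneg (h0 u) a) ?_ (by positivity)
            exact (summable_rpow_of_le_one h0 h1 hf ha).le_tsum u
              fun v _ => Real.rpow_nonneg (h0 v) a
    · filter_upwards [eventually_ge_atTop 1] with a ha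
      have ha0 : 0 < a := by linarith
      have hb : ∑' u, f u ^ a ≤ M ^ (a - 1) * S := by
        rw [hS, ← tsum_mul_left]
        refine (summable_rpow_of_le_one h0 h1 hf ha).tsum_le_tsum (fun u => ?_)
          (hf.mul_left _)
        rcases (h0 u).eq_or_lt with h | h
        · rw [← h, Real.zero_rpow ha0.ne', mul_zero]
        · calc f u ^ a = f u ^ (a - 1) * f u := by
                rw [← Real.rpow_add_one h.ne', sub_add_cancel]
            _ ≤ _ := by
                gcongr
                exact hle u
      calc (∑' u, f u ^ a) ^ (1 / a) ≤ (M ^ (a - 1) * S) ^ (1 / a) :=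
            Real.rpow_le_rpow (tsum_nonneg fun u => Real.rpow_nonneg (h0 u) a) hb (by positivity)
        _ = (M ^ a * (S / M)) ^ (1 / a) := by
            rw [Real.rpow_sub_one hMpos.ne']
            congr 1; ring
        _ = _ := by
            rw [Real.mul_rpow (by positivity) (by positivity), ← Real.rpow_mul hMpos.le,
              mul_one_div_cancel ha0.ne', Real.rpow_one]
  · push Not at hM
    -- This case includes an empty `A`, for which the real supremum is zero as well.
    simp only [hM, Real.iSup_const_zero]
    refine tendsto_const_nhds.congr' ?_
    filter_upwards [eventually_gt_atTop 0] with a ha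
    simp [Real.zero_rpow ha.ne', Real.zero_rpow (inv_ne_zero ha.ne')]

theorem tendsto_order_div_sub_one : Tendsto (fun a : ℝ => a / (a - 1)) atTop (𝓝 1) := by
  have h : Tendsto (fun a : ℝ => 1 + (a - 1)⁻¹) atTop (𝓝 (1 + 0)) :=
    tendsto_const_nhds.add (tendsto_inv_atTop_zero.comp
      (tendsto_atTop_add_const_right atTop (-1) tendsto_id))
  rw [add_zero] at h
  refine h.congr' ?_
  filter_upwards [eventually_gt_atTop 1] with a ha
  have : a - 1 ≠ 0 := by linarith
  field_simp
  ring

/-- `dslope` fills in the value at the base point, so it can be composed with arguments that tend to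
the base point and may equal it. -/
theorem tendsto_dslope_exp : Tendsto (dslope Real.exp 0) (𝓝 0) (𝓝 1) := by
  have h : ContinuousAt (dslope Real.exp 0) 0 :=
    continuousAt_dslope_same.2 Real.differentiableAt_exp
  simpa [ContinuousAt, dslope_same] using h

theorem tendsto_dslope_log : Tendsto (dslope Real.log 1) (𝓝 1) (𝓝 1) := by
  have h : ContinuousAt (dslope Real.log 1) 1 :=
    continuousAt_dslope_same.2 (Real.differentiableAt_log one_ne_zero)
  simpa [ContinuousAt, dslope_same] using h

theorem rpow_sub_self_eq {x : ℝ} (hx : 0 < x) (b : ℝ) :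
    x ^ b - x = (b - 1) * (x * Real.log x) * dslope Real.exp 0 ((b - 1) * Real.log x) := by
  have h := sub_smul_dslope Real.exp 0 ((b - 1) * Real.log x)
  simp only [sub_zero, Real.exp_zero, smul_eq_mul] at h
  have h2 : x ^ b = x * Real.exp ((b - 1) * Real.log x) := by
    conv_lhs => rw [show b = 1 + (b - 1) by ring, Real.rpow_add hx, Real.rpow_one,
      Real.rpow_def_of_pos hx, mul_comm (Real.log x)]
  rw [h2]
  linear_combination (-x) * h

/-- First-order expansion of `x ^ b - x` as `b → 1`, uniform in the base. -/
theorem tendsto_rpow_sub_self_div {x b : ℝ → ℝ} {m c : ℝ} {l : Filter ℝ} (hm : 0 < m)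
    (hx : Tendsto x l (𝓝 m)) (hb : Tendsto b l (𝓝 1))
    (hc : Tendsto (fun a => (b a - 1) / (a - 1)) l (𝓝 c)) :
    Tendsto (fun a => (x a ^ b a - x a) / (a - 1)) l (𝓝 (c * (m * Real.log m))) := by
  have hlog : Tendsto (fun a => Real.log (x a)) l (𝓝 (Real.log m)) := hx.log hm.ne'
  have hz : Tendsto (fun a => (b a - 1) * Real.log (x a)) l (𝓝 0) := by
    have := (hb.sub_const 1).mul hlog
    simpa using this
  have h := (hc.mul (hx.mul hlog)).mul (tendsto_dslope_exp.comp hz)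
  rw [mul_one] at h
  refine h.congr' ?_
  filter_upwards [hx.eventually (lt_mem_nhds hm)] with a ha
  rw [rpow_sub_self_eq ha]
  simp only [Function.comp]
  ring

theorem tendsto_id_nhdsGT_one : Tendsto (fun a : ℝ => a) (𝓝[>] 1) (𝓝 1) :=
  tendsto_id.mono_left nhdsWithin_le_nhds

theorem tendsto_one_div_nhdsGT_one : Tendsto (fun a : ℝ => 1 / a) (𝓝[>] 1) (𝓝 1) := by
  have := (tendsto_id_nhdsGT_one).inv₀ one_ne_zero
  simpa using this

theorem tendsto_self_slope : Tendsto (fun a : ℝ => (a - 1) / (a - 1)) (𝓝[>] 1) (𝓝 1) := by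
  refine tendsto_const_nhds.congr' ?_
  filter_upwards [self_mem_nhdsWithin] with a ha
  have : a - 1 ≠ 0 := by have : 1 < a := ha; linarith
  rw [div_self this]

theorem tendsto_one_div_slope :
    Tendsto (fun a : ℝ => (1 / a - 1) / (a - 1)) (𝓝[>] 1) (𝓝 (-1)) := by
  refine (tendsto_one_div_nhdsGT_one.neg).congr' ?_
  filter_upwards [self_mem_nhdsWithin] with a ha
  have h1 : 1 < a := ha
  have : a - 1 ≠ 0 := by linarith
  have : a ≠ 0 := by linarith
  field_simp
  ring

theorem tendsto_tsum_rpow_mul_one {A : Type*} {p f : A → ℝ} (h0 : ∀ u, 0 ≤ f u)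
    (hfp : ∀ u, f u ≤ p u) (hp1 : ∀ u, p u ≤ 1) (hp : Summable p) :
    Tendsto (fun a : ℝ => ∑' u, p u ^ (a - 1) * f u) (𝓝[>] 1) (𝓝 (∑' u, f u)) := by
  have hf : Summable f := hp.of_nonneg_of_le h0 hfp
  refine tendsto_tsum_of_dominated_convergence hf (fun u => ?_) ?_
  · rcases (h0 u).eq_or_lt with h | h
    · simp [← h]
    · have h2 : Tendsto (fun a : ℝ => p u ^ (a - 1)) (𝓝[>] 1) (𝓝 (p u ^ ((1 : ℝ) - 1))) :=
        tendsto_const_nhds.rpow (tendsto_id_nhdsGT_one.sub_const 1) (Or.inl (h.trans_le (hfp u)).ne')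
      simpa using h2.mul_const (f u)
  · filter_upwards [self_mem_nhdsWithin] with a ha u
    have h1 : 1 < a := ha
    have hpu : 0 ≤ p u := (h0 u).trans (hfp u)
    rw [Real.norm_of_nonneg (mul_nonneg (Real.rpow_nonneg hpu _) (h0 u))]
    exact mul_le_of_le_one_left (h0 u) (Real.rpow_le_one hpu (hp1 u) (by linarith))

theorem rpow_sub_one_mul_self {x : ℝ} (hx : 0 ≤ x) {a : ℝ} (ha : 1 < a) :
    x ^ (a - 1) * x = x ^ a := by
  rcases hx.eq_or_lt with h | h
  · rw [← h, mul_zero, Real.zero_rpow (by linarith)]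
  · rw [← Real.rpow_add_one h.ne', sub_add_cancel]

theorem tendsto_tsum_rpow_one {A : Type*} {f : A → ℝ} (h0 : ∀ u, 0 ≤ f u)
    (h1 : ∀ u, f u ≤ 1) (hf : Summable f) :
    Tendsto (fun a : ℝ => ∑' u, f u ^ a) (𝓝[>] 1) (𝓝 (∑' u, f u)) := by
  refine (tendsto_tsum_rpow_mul_one h0 (fun _ => le_rfl) h1 hf).congr' ?_
  filter_upwards [self_mem_nhdsWithin] with a ha
  exact tsum_congr fun u => rpow_sub_one_mul_self (h0 u) ha

/-- From `e^t ≥ 1 + t`, `r - r^a ≤ (a-1) r (-log r)`, and `-log r ≤ 1/r - 1` bounds this by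
`(a-1)(1-r)`. The bound is uniform in `a`, which dominated convergence needs. -/
theorem abs_rpow_sub_self_div_le_one {r a : ℝ} (h0 : 0 ≤ r) (h1 : r ≤ 1) (ha : 1 < a) :
    |(r ^ a - r) / (a - 1)| ≤ 1 := by
  have ha1 : 0 < a - 1 := by linarith
  rcases h0.eq_or_lt with h | h
  · rw [← h, Real.zero_rpow (by linarith)]
    simp
  · have hle : r ^ a ≤ r := Real.rpow_le_self_of_le_one h0 h1 ha.le
    rw [abs_div, abs_of_nonpos (by linarith), abs_of_pos ha1, div_le_one ha1]
    have e1 : 1 + (a - 1) * Real.log r ≤ r ^ (a - 1) := by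
      rw [Real.rpow_def_of_pos h, mul_comm (Real.log r)]
      linarith [Real.add_one_le_exp ((a - 1) * Real.log r)]
    have e2 : -Real.log r ≤ r⁻¹ - 1 := by
      rw [← Real.log_inv]
      exact Real.log_le_sub_one_of_pos (inv_pos.2 h)
    have e3 : r * -Real.log r ≤ 1 - r := by
      calc r * -Real.log r ≤ r * (r⁻¹ - 1) := by gcongr
        _ = 1 - r := by field_simp
    have e4 := rpow_sub_one_mul_self h0 ha
    nlinarith

/-- With `r = f/p` in `[0,1]`, each quotient is `p^a (r^a - r)/(a-1)`, hence at most `p` in absolute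
value. Subtracting `p^(a-1) f` rather than `f` is what provides a summable bound without any entropy
assumption. -/
theorem tendsto_tsum_rpow_sub_div {A : Type*} {p f : A → ℝ} (h0 : ∀ u, 0 ≤ f u)
    (hfp : ∀ u, f u ≤ p u) (hp1 : ∀ u, p u ≤ 1) (hp : Summable p) :
    Tendsto (fun a : ℝ => (∑' u, f u ^ a - ∑' u, p u ^ (a - 1) * f u) / (a - 1)) (𝓝[>] 1)
      (𝓝 (∑' u, f u * Real.log (f u / p u))) := by
  have hf : Summable f := hp.of_nonneg_of_le h0 hfp
  have hp0 : ∀ u, 0 ≤ p u := fun u => (h0 u).trans (hfp u)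
  have hr0 : ∀ u, 0 ≤ f u / p u := fun u => div_nonneg (h0 u) (hp0 u)
  have hr1 : ∀ u, f u / p u ≤ 1 := fun u => div_le_one_of_le₀ (hfp u) (hp0 u)
  have key : ∀ a : ℝ, 1 < a → ∀ u, (f u ^ a - p u ^ (a - 1) * f u) / (a - 1)
      = p u ^ a * (((f u / p u) ^ a - f u / p u) / (a - 1)) := by
    intro a ha u
    rcases (hp0 u).eq_or_lt with h | h
    · have : f u = 0 := le_antisymm ((hfp u).trans h.symm.le) (h0 u)
      simp [this, ← h, Real.zero_rpow (show a ≠ 0 by linarith)]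
    · rw [Real.div_rpow (h0 u) (hp0 u), ← rpow_sub_one_mul_self (hp0 u) ha]
      have h2 := Real.rpow_pos_of_pos h (a - 1)
      field_simp
  have hlim : Tendsto (fun a : ℝ => ∑' u, (f u ^ a - p u ^ (a - 1) * f u) / (a - 1)) (𝓝[>] 1)
      (𝓝 (∑' u, f u * Real.log (f u / p u))) := by
    refine tendsto_tsum_of_dominated_convergence hp (fun u => ?_) ?_
    · rcases (h0 u).eq_or_lt with h | h
      · simp only [← h, mul_zero, sub_zero, zero_mul]
        refine tendsto_const_nhds.congr' ?_
        filter_upwards [self_mem_nhdsWithin] with a ha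
        have : 1 < a := ha
        rw [Real.zero_rpow (by linarith), zero_div]
      · have hpu := h.trans_le (hfp u)
        have h2 : Tendsto (fun a : ℝ => p u ^ a) (𝓝[>] 1) (𝓝 (p u ^ (1 : ℝ))) :=
          tendsto_const_nhds.rpow tendsto_id_nhdsGT_one (Or.inl hpu.ne')
        have h3 := h2.mul (tendsto_rpow_sub_self_div (div_pos h hpu)
          (tendsto_const_nhds (x := f u / p u)) tendsto_id_nhdsGT_one tendsto_self_slope)
        have h4 : p u ^ (1 : ℝ) * (1 * (f u / p u * Real.log (f u / p u)))
            = f u * Real.log (f u / p u) := by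
          rw [Real.rpow_one]; field_simp
        rw [h4] at h3
        refine h3.congr' ?_
        filter_upwards [self_mem_nhdsWithin] with a ha
        exact (key a ha u).symm
    · filter_upwards [self_mem_nhdsWithin] with a ha u
      have h1 : 1 < a := ha
      rw [key a ha u, norm_mul, Real.norm_of_nonneg (Real.rpow_nonneg (hp0 u) a)]
      calc _ ≤ p u ^ a * 1 := by
            gcongr
            · exact Real.rpow_nonneg (hp0 u) a
            · exact abs_rpow_sub_self_div_le_one (hr0 u) (hr1 u) h1
        _ ≤ p u := by
            rw [mul_one]
            exact Real.rpow_le_self_of_le_one (hp0 u) (hp1 u) h1.le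
  refine hlim.congr' ?_
  filter_upwards [self_mem_nhdsWithin] with a ha
  have h1 : 1 < a := ha
  rw [tsum_div_const, Summable.tsum_sub]
  · exact summable_rpow_of_le_one h0 (fun u => (hfp u).trans (hp1 u)) hf h1.le
  · refine hf.of_nonneg_of_le (fun u => mul_nonneg (Real.rpow_nonneg (hp0 u) _) (h0 u))
      fun u => ?_
    exact mul_le_of_le_one_left (h0 u) (Real.rpow_le_one (hp0 u) (hp1 u) (by linarith))

end Limits

/-! ### The leakage of a fixed joint law at orders `∞` and `1`. -/

section JointLaw

variable {A Y Z : Type*}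

theorem condAlphaLeakage_of_lt {α : ℝ≥0∞} (h1 : 1 < α) (h2 : α ≠ ∞) (J : PMF (A × Y × Z)) :
    condAlphaLeakage J α = condAlphaLeakageReal J α.toReal := by
  rw [condAlphaLeakage, orderExtension, if_neg h1.ne', if_neg h2]


theorem PMF.toReal_le_one {I : Type*} (J : PMF I) (i : I) : (J i).toReal ≤ 1 := by
  have := ENNReal.toReal_mono ENNReal.one_ne_top (J.coe_le_one i)
  simpa using this

theorem summable_left_toReal {I : Type*} (J : PMF (A × I)) (i : I) :
    Summable fun u => (J (u, i)).toReal :=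
  ENNReal.summable_toReal ((tsum_left_le_one J i).trans_lt ENNReal.one_lt_top).ne

variable [Fintype Y]

theorem summable_sum_toReal (J : PMF (A × Y × Z)) (z : Z) :
    Summable fun u => ∑ y, (J (u, y, z)).toReal :=
  summable_sum fun y _ => summable_left_toReal J (y, z)

theorem le_sum_toReal (J : PMF (A × Y × Z)) (y : Y) (z : Z) (u : A) :
    (J (u, y, z)).toReal ≤ ∑ y, (J (u, y, z)).toReal :=
  Finset.single_le_sum (f := fun y => (J (u, y, z)).toReal) (fun _ _ => ENNReal.toReal_nonneg)
    (Finset.mem_univ y)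

variable [Fintype Z]

theorem sum_toReal_le_one (J : PMF (A × Y × Z)) (z : Z) (u : A) :
    ∑ y, (J (u, y, z)).toReal ≤ 1 := by
  rw [← ENNReal.toReal_sum fun y _ => PMF.apply_ne_top J _]
  have := ENNReal.toReal_mono ENNReal.one_ne_top
    ((ENNReal.le_tsum u).trans (tsum_fst_le_one J z))
  simpa using this

theorem sum_tsum_toReal (J : PMF (A × Y × Z)) :
    ∑ z, ∑' u, ∑ y, (J (u, y, z)).toReal = 1 := by
  have h : ∀ z, ∑' u, ∑ y, (J (u, y, z)).toReal = (∑' u, ∑ y, J (u, y, z)).toReal := by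
    intro z
    have h1 : ∑' u, ∑ y, J (u, y, z) ≠ ∞ :=
      ((tsum_fst_le_one J z).trans_lt ENNReal.one_lt_top).ne
    rw [ENNReal.tsum_toReal_eq fun u => ENNReal.ne_top_of_tsum_ne_top h1 u]
    exact tsum_congr fun u => (ENNReal.toReal_sum fun y _ => PMF.apply_ne_top J _).symm
  simp only [h]
  rw [← ENNReal.toReal_sum fun z _ => ((tsum_fst_le_one J z).trans_lt ENNReal.one_lt_top).ne]
  have : ∑ z, ∑' u, ∑ y, J (u, y, z) = 1 := by
    rw [← J.tsum_coe, tsum_triple, Fintype.sum_prod_type, Finset.sum_comm]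
    exact Finset.sum_congr rfl fun z _ => Summable.tsum_finsetSum fun _ _ => ENNReal.summable
  rw [this, ENNReal.toReal_one]

/-- The ratio whose logarithm is the leakage of order `∞`. -/
noncomputable def supRatio (J : PMF (A × Y × Z)) : ℝ :=
  (∑ i : Y × Z, ⨆ u, (J (u, i)).toReal) / (∑ z, ⨆ u, ∑ y, (J (u, y, z)).toReal)

theorem exists_toReal_pos {I : Type*} (J : PMF I) : ∃ i, 0 < (J i).toReal := by
  obtain ⟨i, hi⟩ := J.support_nonempty
  exact ⟨i, ENNReal.toReal_pos ((J.mem_support_iff i).1 hi) (PMF.apply_ne_top J i)⟩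

theorem sum_iSup_pos (J : PMF (A × Y × Z)) : 0 < ∑ i : Y × Z, ⨆ u, (J (u, i)).toReal := by
  obtain ⟨⟨u, i⟩, hi⟩ := exists_toReal_pos J
  refine Finset.sum_pos' (fun i _ => Real.iSup_nonneg fun u => ENNReal.toReal_nonneg)
    ⟨i, Finset.mem_univ i, ?_⟩
  exact hi.trans_le (le_ciSup (f := fun u => (J (u, i)).toReal)
    ⟨1, by rintro _ ⟨u, rfl⟩; exact J.toReal_le_one _⟩ u)

theorem sum_iSup_sum_pos (J : PMF (A × Y × Z)) :
    0 < ∑ z, ⨆ u, ∑ y, (J (u, y, z)).toReal := by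
  obtain ⟨⟨u, y, z⟩, hi⟩ := exists_toReal_pos J
  refine Finset.sum_pos' (fun i _ => Real.iSup_nonneg fun u =>
    Finset.sum_nonneg fun _ _ => ENNReal.toReal_nonneg) ⟨z, Finset.mem_univ z, ?_⟩
  exact (hi.trans_le (le_sum_toReal J y z u)).trans_le
    (le_ciSup (f := fun u => ∑ y, (J (u, y, z)).toReal)
      ⟨1, by rintro _ ⟨u, rfl⟩; exact sum_toReal_le_one J z u⟩ u)

theorem tendsto_condAlphaLeakageReal_atTop (J : PMF (A × Y × Z)) :
    Tendsto (condAlphaLeakageReal J) atTop (𝓝 (Real.log (supRatio J))) := by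
  have hN : Tendsto (fun a : ℝ => ∑ i : Y × Z, (∑' u, (J (u, i)).toReal ^ a) ^ (1 / a)) atTop
      (𝓝 (∑ i : Y × Z, ⨆ u, (J (u, i)).toReal)) :=
    tendsto_finsetSum _ fun i _ => tendsto_tsum_rpow_atTop (fun _ => ENNReal.toReal_nonneg)
      (fun _ => J.toReal_le_one _) (summable_left_toReal J i)
  have hD : Tendsto (fun a : ℝ => ∑ z, (∑' u, (∑ y, (J (u, y, z)).toReal) ^ a) ^ (1 / a)) atTop
      (𝓝 (∑ z, ⨆ u, ∑ y, (J (u, y, z)).toReal)) :=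
    tendsto_finsetSum _ fun z _ => tendsto_tsum_rpow_atTop
      (fun _ => Finset.sum_nonneg fun _ _ => ENNReal.toReal_nonneg)
      (fun u => sum_toReal_le_one J z u) (summable_sum_toReal J z)
  have h := tendsto_order_div_sub_one.mul ((hN.div hD (sum_iSup_sum_pos J).ne').log
    (div_pos (sum_iSup_pos J) (sum_iSup_sum_pos J)).ne')
  rw [one_mul] at h
  refine h.congr' ?_
  filter_upwards [eventually_gt_atTop 1] with a ha
  rw [condAlphaLeakageReal_eq J ha]
  rfl

theorem condAlphaLeakage_top (J : PMF (A × Y × Z)) :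
    condAlphaLeakage J ∞ = Real.log (supRatio J) := by
  rw [condAlphaLeakage, orderExtension, if_neg ENNReal.top_ne_one, if_pos rfl]
  exact (tendsto_condAlphaLeakageReal_atTop J).limUnder_eq

/-- The conditional mutual information between the first two components given the third, in a
form that is finite even when the first component has infinite entropy. -/
noncomputable def condMI (J : PMF (A × Y × Z)) : ℝ :=
  ∑ z, ∑ y, ((∑' u, (J (u, y, z)).toReal *
      Real.log ((J (u, y, z)).toReal / ∑ y', (J (u, y', z)).toReal))
    - (∑' u, (J (u, y, z)).toReal) * Real.log (∑' u, (J (u, y, z)).toReal)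
    + (∑' u, (J (u, y, z)).toReal) * Real.log (∑' u, ∑ y', (J (u, y', z)).toReal))

/-- Write `V = ∑ f^a`, `M = ∑ p^(a-1) f`, `B = ∑ p^a`. The numerator is `(V^(1/a) - V) + (V - M) -
(M/B)(B^(1/a) - B)`. The outer differences are scalar expansions at a moving base; the middle one is
the dominated sum. Over `y` the subtracted terms add up to `B^(1/a)`, a summand of `D`. -/
theorem tendsto_leakage_term {A : Type*} {p f : A → ℝ} (h0 : ∀ u, 0 ≤ f u)
    (hfp : ∀ u, f u ≤ p u) (hp1 : ∀ u, p u ≤ 1) (hp : Summable p) :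
    Tendsto (fun a : ℝ => ((∑' u, f u ^ a) ^ (1 / a)
        - (∑' u, p u ^ (a - 1) * f u) * ((∑' u, p u ^ a) ^ (1 / a) / ∑' u, p u ^ a)) / (a - 1))
      (𝓝[>] 1)
      (𝓝 ((∑' u, f u * Real.log (f u / p u)) - (∑' u, f u) * Real.log (∑' u, f u)
        + (∑' u, f u) * Real.log (∑' u, p u))) := by
  have hf : Summable f := hp.of_nonneg_of_le h0 hfp
  have hf1 : ∀ u, f u ≤ 1 := fun u => (hfp u).trans (hp1 u)
  have hp0 : ∀ u, 0 ≤ p u := fun u => (h0 u).trans (hfp u)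
  by_cases hz : ∀ u, f u = 0
  · simp only [hz, zero_mul, mul_zero, tsum_zero, sub_zero, add_zero]
    refine tendsto_const_nhds.congr' ?_
    filter_upwards [self_mem_nhdsWithin] with a ha
    have ha1 : (0 : ℝ) < a := lt_trans one_pos ha
    simp [Real.zero_rpow ha1.ne', Real.zero_rpow (inv_ne_zero ha1.ne')]
  · push Not at hz
    obtain ⟨u₀, hu₀⟩ := hz
    have hmf : 0 < ∑' u, f u := hf.tsum_pos h0 u₀ (lt_of_le_of_ne (h0 u₀) hu₀.symm)
    have hmp : 0 < ∑' u, p u := hmf.trans_le (hf.tsum_le_tsum hfp hp)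
    have hV := tendsto_tsum_rpow_one h0 hf1 hf
    have hB := tendsto_tsum_rpow_one hp0 hp1 hp
    have hM := tendsto_tsum_rpow_mul_one h0 hfp hp1 hp
    have t1 := tendsto_rpow_sub_self_div hmf hV tendsto_one_div_nhdsGT_one tendsto_one_div_slope
    have t2 := tendsto_tsum_rpow_sub_div h0 hfp hp1 hp
    have t3 := tendsto_rpow_sub_self_div hmp hB tendsto_one_div_nhdsGT_one tendsto_one_div_slope
    have t := (t1.add t2).sub ((hM.div hB hmp.ne').mul t3)
    have hlim : -1 * ((∑' u, f u) * Real.log (∑' u, f u)) + ∑' u, f u * Real.log (f u / p u)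
        - (∑' u, f u) / (∑' u, p u) * (-1 * ((∑' u, p u) * Real.log (∑' u, p u)))
        = (∑' u, f u * Real.log (f u / p u)) - (∑' u, f u) * Real.log (∑' u, f u)
        + (∑' u, f u) * Real.log (∑' u, p u) := by
      field_simp
      ring
    rw [hlim] at t
    refine t.congr' ?_
    filter_upwards [self_mem_nhdsWithin, hB.eventually (lt_mem_nhds hmp)] with a ha hBa
    have h1 : a - 1 ≠ 0 := by have : 1 < a := ha; linarith
    simp only [Pi.div_apply]
    field_simp
    ring

theorem sum_tsum_rpow_mul {p : A → ℝ} {j : Y → A → ℝ} (h0 : ∀ y u, 0 ≤ j y u)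
    (hpj : ∀ u, p u = ∑ y, j y u) (hp1 : ∀ u, p u ≤ 1) (hp : Summable p) {a : ℝ} (ha : 1 < a) :
    ∑ y, ∑' u, p u ^ (a - 1) * j y u = ∑' u, p u ^ a := by
  have hp0 : ∀ u, 0 ≤ p u := fun u => by rw [hpj]; exact Finset.sum_nonneg fun y _ => h0 y u
  have hjp : ∀ y u, j y u ≤ p u := fun y u => by
    rw [hpj]
    exact Finset.single_le_sum (f := fun y => j y u) (fun y _ => h0 y u) (Finset.mem_univ y)
  rw [← Summable.tsum_finsetSum]
  · refine tsum_congr fun u => ?_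
    rw [← Finset.mul_sum, ← hpj, rpow_sub_one_mul_self (hp0 u) ha]
  · intro y _
    refine (hp.of_nonneg_of_le (h0 y) (hjp y)).of_nonneg_of_le
      (fun u => mul_nonneg (Real.rpow_nonneg (hp0 u) _) (h0 y u)) fun u => ?_
    exact mul_le_of_le_one_left (h0 y u) (Real.rpow_le_one (hp0 u) (hp1 u) (by linarith))

theorem tendsto_condAlphaLeakageReal_one (J : PMF (A × Y × Z)) :
    Tendsto (condAlphaLeakageReal J) (𝓝[>] 1) (𝓝 (condMI J)) := by
  set j : Y → Z → A → ℝ := fun y z u => (J (u, y, z)).toReal with hj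
  set p : Z → A → ℝ := fun z u => ∑ y, j y z u with hp
  have hj0 : ∀ y z u, 0 ≤ j y z u := fun y z u => ENNReal.toReal_nonneg
  have hp0 : ∀ z u, 0 ≤ p z u := fun z u => Finset.sum_nonneg fun y _ => hj0 y z u
  have hjp : ∀ y z u, j y z u ≤ p z u := fun y z u => le_sum_toReal J y z u
  have hp1 : ∀ z u, p z u ≤ 1 := fun z u => sum_toReal_le_one J z u
  have hps : ∀ z, Summable (p z) := fun z => summable_sum_toReal J z
  set D : ℝ → ℝ := fun a => ∑ z, (∑' u, p z u ^ a) ^ (1 / a) with hD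
  set N : ℝ → ℝ := fun a => ∑ z, ∑ y, (∑' u, j y z u ^ a) ^ (1 / a) with hN
  have hD1 : Tendsto D (𝓝[>] 1) (𝓝 1) := by
    suffices h : Tendsto D (𝓝[>] 1) (𝓝 (∑ z, ∑' u, p z u)) by
      rwa [sum_tsum_toReal J] at h
    refine tendsto_finsetSum _ fun z _ => ?_
    have := (tendsto_tsum_rpow_one (hp0 z) (hp1 z) (hps z)).rpow tendsto_one_div_nhdsGT_one
      (Or.inr one_pos)
    rwa [Real.rpow_one] at this
  have hND : Tendsto (fun a => (N a - D a) / (a - 1)) (𝓝[>] 1) (𝓝 (condMI J)) := by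
    have h : Tendsto (fun a : ℝ => ∑ z, ∑ y, ((∑' u, j y z u ^ a) ^ (1 / a)
        - (∑' u, p z u ^ (a - 1) * j y z u) *
          ((∑' u, p z u ^ a) ^ (1 / a) / ∑' u, p z u ^ a)) / (a - 1)) (𝓝[>] 1)
        (𝓝 (condMI J)) :=
      tendsto_finsetSum _ fun z _ => tendsto_finsetSum _ fun y _ =>
        tendsto_leakage_term (hj0 y z) (hjp y z) (hp1 z) (hps z)
    refine h.congr' ?_
    filter_upwards [self_mem_nhdsWithin] with a ha
    have ha1 : 1 < a := ha
    simp only [hN, hD]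
    rw [← Finset.sum_sub_distrib, Finset.sum_div]
    refine Finset.sum_congr rfl fun z _ => ?_
    rw [← Finset.sum_div, Finset.sum_sub_distrib, ← Finset.sum_mul,
      sum_tsum_rpow_mul (fun y u => hj0 y z u) (fun u => rfl) (hp1 z) (hps z) ha1]
    congr 2
    -- In a state of probability zero the divisor vanishes, and so does the norm.
    by_cases h0 : ∑' u, p z u ^ a = 0
    · rw [h0, Real.zero_rpow (by positivity)]; simp
    · exact mul_div_cancel₀ _ h0
  have hg : Tendsto (fun a => (N a - D a) / (a - 1) / D a) (𝓝[>] 1) (𝓝 (condMI J)) := by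
    have h := hND.div hD1 one_ne_zero
    rwa [div_one] at h
  have hsub : Tendsto (fun a : ℝ => a - 1) (𝓝[>] 1) (𝓝 0) := by
    simpa using tendsto_id_nhdsGT_one.sub_const 1
  have hrat : Tendsto (fun a => N a / D a) (𝓝[>] 1) (𝓝 1) := by
    have h := (hsub.mul hg).const_add 1
    rw [zero_mul, add_zero] at h
    refine h.congr' ?_
    filter_upwards [self_mem_nhdsWithin, hD1.eventually (lt_mem_nhds one_pos)] with a ha hDa
    have h1 : a - 1 ≠ 0 := by have : 1 < a := ha; linarith
    field_simp
    ring
  -- The leakage factors as `a`, times `(N - D)/((a-1) D)`, times the slope of `log` between `1` and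
  -- `N/D`; the outer factors tend to one.
  have hfin := (tendsto_id_nhdsGT_one.mul hg).mul (tendsto_dslope_log.comp hrat)
  rw [one_mul, mul_one] at hfin
  refine hfin.congr' ?_
  filter_upwards [self_mem_nhdsWithin, hD1.eventually (lt_mem_nhds one_pos)] with a ha hDa
  have ha1 : 1 < a := ha
  have h1 : a - 1 ≠ 0 := by linarith
  have hs := sub_smul_dslope Real.log 1 (N a / D a)
  rw [Real.log_one, sub_zero, smul_eq_mul] at hs
  have hN' : ∑ i : Y × Z, (∑' u, (J (u, i)).toReal ^ a) ^ (1 / a) = N a := by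
    rw [Fintype.sum_prod_type, Finset.sum_comm]
  rw [condAlphaLeakageReal_eq J ha1, hN']
  change _ = a / (a - 1) * Real.log (N a / D a)
  rw [← hs]
  simp only [Function.comp]
  field_simp

theorem condAlphaLeakage_one (J : PMF (A × Y × Z)) : condAlphaLeakage J 1 = condMI J := by
  rw [condAlphaLeakage, orderExtension, if_pos rfl]
  exact (tendsto_condAlphaLeakageReal_one J).limUnder_eq

end JointLaw

/-! ### Marginals, the Markov factorisation, and the upper bound at finite orders. -/

section Marginals

/-- The injection `e` parametrises the fibre over `b`, so each marginal becomes a sum over the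
forgotten coordinates. -/
theorem PMF.map_apply_eq_tsum {α β ι : Type*} (J : PMF α) (f : α → β) (b : β) (e : ι → α)
    (he : Function.Injective e) (h1 : ∀ i, f (e i) = b) (h2 : ∀ a, f a = b → ∃ i, e i = a) :
    J.map f b = ∑' i, J (e i) := by
  classical
  rw [PMF.map_apply, ← he.tsum_eq]
  · exact tsum_congr fun i => by rw [if_pos (h1 i).symm]
  · intro a ha
    rw [Function.mem_support] at ha
    refine h2 a ?_
    by_contra h
    exact ha (if_neg fun h' => h h'.symm)

variable {A X Y Z : Type*} [Fintype X] [Fintype Y] [Fintype Z]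

theorem margXZ_apply (P : PMF (X × Y × Z)) (x : X) (z : Z) :
    margXZ P (x, z) = ∑ y, P (x, y, z) := by
  rw [margXZ, PMF.map_apply_eq_tsum P _ (x, z) (fun y => (x, y, z)), tsum_fintype]
  · intro y y' h; simpa using h
  · intro y; rfl
  · rintro ⟨x', y', z'⟩ h
    simp only [Prod.mk.injEq] at h
    exact ⟨y', by rw [h.1, h.2]⟩

theorem margYZ_apply (P : PMF (X × Y × Z)) (y : Y) (z : Z) :
    margYZ P (y, z) = ∑ x, P (x, y, z) := by
  rw [margYZ, PMF.map_apply_eq_tsum P _ (y, z) (fun x => (x, y, z)), tsum_fintype]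
  · intro y y' h; simpa using h
  · intro y; rfl
  · rintro ⟨x', y', z'⟩ h
    simp only [Prod.mk.injEq] at h
    exact ⟨x', by rw [h.1, h.2]⟩

theorem margZ_apply (P : PMF (X × Y × Z)) (z : Z) :
    margZ P z = ∑ x, margXZ P (x, z) := by
  simp only [margXZ_apply]
  rw [margZ, PMF.map_apply_eq_tsum P _ z (fun w : X × Y => (w.1, w.2, z)), tsum_fintype,
    Fintype.sum_prod_type]
  · rintro ⟨x, y⟩ ⟨x', y'⟩ h; simpa using h
  · intro y; rfl
  · rintro ⟨x', y', z'⟩ h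
    exact ⟨(x', y'), by simpa using h.symm⟩

theorem margUYZ_apply (J : PMF (A × X × Y × Z)) (u : A) (y : Y) (z : Z) :
    margUYZ J (u, y, z) = ∑ x, J (u, x, y, z) := by
  rw [margUYZ, PMF.map_apply_eq_tsum J _ (u, y, z) (fun x => (u, x, y, z)), tsum_fintype]
  · intro y y' h; simpa using h
  · intro y; rfl
  · rintro ⟨u', x', y', z'⟩ h
    simp only [Prod.mk.injEq] at h
    exact ⟨x', by rw [h.1, h.2.1, h.2.2]⟩

theorem margUXZ_apply (J : PMF (A × X × Y × Z)) (u : A) (x : X) (z : Z) :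
    margUXZ J (u, x, z) = ∑ y, J (u, x, y, z) := by
  rw [margUXZ, PMF.map_apply_eq_tsum J _ (u, x, z) (fun y => (u, x, y, z)), tsum_fintype]
  · intro y y' h; simpa using h
  · intro y; rfl
  · rintro ⟨u', x', y', z'⟩ h
    simp only [Prod.mk.injEq] at h
    exact ⟨y', by rw [h.1, h.2.1, h.2.2]⟩

theorem map_snd_apply (J : PMF (A × X × Y × Z)) (i : X × Y × Z) :
    J.map Prod.snd i = ∑' u, J (u, i) := by
  rw [PMF.map_apply_eq_tsum J _ i (fun u => (u, i))]
  · intro y y' h; simpa using h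
  · intro y; rfl
  · rintro ⟨u', i'⟩ h
    exact ⟨u', by rw [← h]⟩

theorem margXZ_eq_zero_of (P : PMF (X × Y × Z)) {x : X} {z : Z} (h : margZ P z = 0) :
    margXZ P (x, z) = 0 := by
  rw [margZ_apply, Finset.sum_eq_zero_iff] at h
  exact h x (Finset.mem_univ x)

theorem apply_eq_zero_of_margXZ (P : PMF (X × Y × Z)) {x : X} {z : Z} (y : Y)
    (h : margXZ P (x, z) = 0) : P (x, y, z) = 0 := by
  rw [margXZ_apply, Finset.sum_eq_zero_iff] at h
  exact h y (Finset.mem_univ y)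

theorem margXZ_mul_condY (P : PMF (X × Y × Z)) (x : X) (y : Y) (z : Z) :
    margXZ P (x, z) * condY P z x y = P (x, y, z) := by
  by_cases h : margXZ P (x, z) = 0
  · rw [h, zero_mul, apply_eq_zero_of_margXZ P y h]
  · rw [condY, ENNReal.mul_div_cancel h (PMF.apply_ne_top _ _)]

theorem sum_condY (P : PMF (X × Y × Z)) {x : X} {z : Z} (h : margXZ P (x, z) ≠ 0) :
    ∑ y, condY P z x y = 1 := by
  have e := margXZ_apply P x z
  simp only [condY, div_eq_mul_inv]
  rw [← Finset.sum_mul, ← e, ENNReal.mul_inv_cancel h (PMF.apply_ne_top _ _)]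

theorem condY_le_one (P : PMF (X × Y × Z)) (x : X) (y : Y) (z : Z) : condY P z x y ≤ 1 := by
  refine ENNReal.div_le_of_le_mul ?_
  rw [one_mul, margXZ_apply]
  exact Finset.single_le_sum (f := fun y => P (x, y, z)) (fun _ _ => zero_le) (Finset.mem_univ y)

theorem condY_ne_top (P : PMF (X × Y × Z)) (x : X) (y : Y) (z : Z) : condY P z x y ≠ ∞ :=
  ((condY_le_one P x y z).trans_lt ENNReal.one_lt_top).ne

theorem condX_eq_zero_iff (P : PMF (X × Y × Z)) (x : X) (z : Z) :
    condX P z x = 0 ↔ margXZ P (x, z) = 0 := by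
  rw [condX, ENNReal.div_eq_zero_iff]
  simp [PMF.apply_ne_top]

namespace IsMarkovExtension

variable {J : PMF (A × X × Y × Z)} {P : PMF (X × Y × Z)}

theorem apply_eq_zero (h : IsMarkovExtension J P) {x : X} {z : Z} (u : A) (y : Y)
    (h0 : margXZ P (x, z) = 0) : J (u, x, y, z) = 0 := by
  have h1 := apply_eq_zero_of_margXZ P y h0
  rw [← h.marginal, map_snd_apply, ENNReal.tsum_eq_zero] at h1
  exact h1 u

theorem margUXZ_eq_zero (h : IsMarkovExtension J P) {x : X} {z : Z} (u : A)
    (h0 : margXZ P (x, z) = 0) : margUXZ J (u, x, z) = 0 := by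
  rw [margUXZ_apply]
  exact Finset.sum_eq_zero fun y _ => h.apply_eq_zero u y h0

/-- Where `P(x,z) = 0` the Markov identity says nothing, but the marginal condition makes both sides
vanish. -/
theorem apply_eq (h : IsMarkovExtension J P) (u : A) (x : X) (y : Y) (z : Z) :
    J (u, x, y, z) = margUXZ J (u, x, z) * condY P z x y := by
  by_cases h0 : margXZ P (x, z) = 0
  · rw [h.apply_eq_zero u y h0, h.margUXZ_eq_zero u h0, zero_mul]
  · rw [condY, ← mul_div_assoc, ← h.markov,
      ENNReal.mul_div_cancel_right h0 (PMF.apply_ne_top _ _)]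

theorem margUYZ_eq (h : IsMarkovExtension J P) (u : A) (y : Y) (z : Z) :
    margUYZ J (u, y, z) = ∑ x, margUXZ J (u, x, z) * condY P z x y := by
  rw [margUYZ_apply]
  exact Finset.sum_congr rfl fun x _ => h.apply_eq u x y z

theorem sum_margUYZ (J : PMF (A × X × Y × Z)) (u : A) (z : Z) :
    ∑ y, margUYZ J (u, y, z) = ∑ x, margUXZ J (u, x, z) := by
  simp only [margUYZ_apply, margUXZ_apply]
  exact Finset.sum_comm

theorem tsum_margUXZ (h : IsMarkovExtension J P) (x : X) (z : Z) :
    ∑' u, margUXZ J (u, x, z) = margXZ P (x, z) := by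
  simp only [margUXZ_apply]
  rw [Summable.tsum_finsetSum fun _ _ => ENNReal.summable, margXZ_apply]
  refine Finset.sum_congr rfl fun y _ => ?_
  rw [← map_snd_apply, h.marginal]

theorem tsum_margUYZ (h : IsMarkovExtension J P) (y : Y) (z : Z) :
    ∑' u, margUYZ J (u, y, z) = margYZ P (y, z) := by
  simp only [margUYZ_apply]
  rw [Summable.tsum_finsetSum fun _ _ => ENNReal.summable, margYZ_apply]
  refine Finset.sum_congr rfl fun x _ => ?_
  rw [← map_snd_apply, h.marginal]

end IsMarkovExtension

/-- The sum whose logarithm defines `eventSibsonReal`. -/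
noncomputable def sibsonSum (P : PMF (X × Y × Z)) (z : Z) (Q : PMF X) (a : ℝ) : ℝ≥0∞ :=
  ∑ y, (∑ x, Q x * condY P z x y ^ a) ^ (1 / a)

/-- The exponential of the largest leakage of order `∞` through the channel in state `z`. -/
noncomputable def chanSup (P : PMF (X × Y × Z)) (z : Z) : ℝ≥0∞ := ∑ y, ⨆ x, condY P z x y

/-- A power mean is at most the maximum. The bound depends on neither `Q` nor `a`, which lets it
survive `a → ∞`. -/
theorem sibsonSum_le_chanSup (P : PMF (X × Y × Z)) (z : Z) (Q : PMF X) {a : ℝ} (ha : 1 < a) :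
    sibsonSum P z Q a ≤ chanSup P z := by
  have ha0 : 0 < a := by linarith
  refine Finset.sum_le_sum fun y _ => ?_
  calc (∑ x, Q x * condY P z x y ^ a) ^ (1 / a)
      ≤ (∑ x, Q x * (⨆ x, condY P z x y) ^ a) ^ (1 / a) := by
        gcongr with x
        exact le_iSup (fun x => condY P z x y) x
    _ = _ := by
        rw [← Finset.sum_mul, ← tsum_fintype (L := .unconditional _), Q.tsum_coe, one_mul,
          ← ENNReal.rpow_mul, mul_one_div_cancel ha0.ne', ENNReal.rpow_one]

theorem chanSup_ne_top (P : PMF (X × Y × Z)) (z : Z) : chanSup P z ≠ ∞ := by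
  refine ENNReal.sum_ne_top.2 fun y _ => ?_
  exact ((iSup_le fun x => condY_le_one P x y z).trans_lt ENNReal.one_lt_top).ne

theorem sibsonSum_ne_top (P : PMF (X × Y × Z)) (z : Z) (Q : PMF X) {a : ℝ} (ha : 1 < a) :
    sibsonSum P z Q a ≠ ∞ :=
  ((sibsonSum_le_chanSup P z Q ha).trans_lt (chanSup_ne_top P z).lt_top).ne

/-- Weighted power mean inequality for weights of finite total mass. -/
theorem rpow_sum_mul_le {ι : Type*} [Fintype ι] (m V : ι → ℝ≥0∞) (hm : ∑ x, m x ≠ ∞) {a : ℝ}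
    (ha : 1 < a) :
    (∑ x, m x * V x) ^ a ≤ (∑ x, m x) ^ (a - 1) * ∑ x, m x * V x ^ a := by
  have ha0 : 0 < a := by linarith
  set p := ∑ x, m x with hp
  by_cases h0 : p = 0
  · have : ∀ x, m x = 0 := fun x => by
      rw [hp, Finset.sum_eq_zero_iff] at h0
      exact h0 x (Finset.mem_univ x)
    simp [this, ha0]
  · have hw : ∑ x, m x / p = 1 := by
      simp only [div_eq_mul_inv]
      rw [← Finset.sum_mul, ← hp, ENNReal.mul_inv_cancel h0 hm]
    have h := ENNReal.rpow_arith_mean_le_arith_mean_rpow Finset.univ (fun x => m x / p) V hw ha.le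
    have e : ∀ G : ι → ℝ≥0∞, ∑ x, m x * G x = p * ∑ x, m x / p * G x := by
      intro G
      rw [Finset.mul_sum]
      refine Finset.sum_congr rfl fun x _ => ?_
      rw [← mul_assoc, ENNReal.mul_div_cancel h0 hm]
    rw [e V, e (fun x => V x ^ a), ENNReal.mul_rpow_of_nonneg _ _ ha0.le, ← mul_assoc]
    have e2 : p ^ (a - 1) * p = p ^ a := by
      conv_lhs => enter [2]; rw [← ENNReal.rpow_one p]
      rw [← ENNReal.rpow_add _ _ h0 hm, sub_add_cancel]
    rw [e2]
    gcongr

theorem ennreal_rpow_sub_one_mul_self {p : ℝ≥0∞} (hp : p ≠ ∞) {a : ℝ} (ha : 1 < a) :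
    p ^ (a - 1) * p = p ^ a := by
  by_cases h0 : p = 0
  · simp [h0, show (0 : ℝ) < a by linarith]
  · conv_lhs => enter [2]; rw [← ENNReal.rpow_one p]
    rw [← ENNReal.rpow_add _ _ h0 hp, sub_add_cancel]

/-- The witness is the law of `X` after reweighting `(U, X)` in state `z` by `P(u,z)^(a-1)`. This is
the factor produced by the power mean inequality, and the total mass of the reweighting is exactly
`B`. -/
theorem IsMarkovExtension.exists_sibsonSum_ge {J : PMF (A × X × Y × Z)} {P : PMF (X × Y × Z)}
    (h : IsMarkovExtension J P) (z : Z) {a : ℝ} (ha : 1 < a)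
    (hB : ∑' u, (∑ y, margUYZ J (u, y, z)) ^ a ≠ 0) :
    ∃ Q : PMF X, AbsContCondX Q P z ∧ ∑ y, (∑' u, margUYZ J (u, y, z) ^ a) ^ (1 / a)
      ≤ (∑' u, (∑ y, margUYZ J (u, y, z)) ^ a) ^ (1 / a) * sibsonSum P z Q a := by
  have ha0 : 0 < a := by linarith
  set B := ∑' u, (∑ y, margUYZ J (u, y, z)) ^ a with hBdef
  have hBt : B ≠ ∞ :=
    ((tsum_rpow_le_one (tsum_fst_le_one _ z) ha.le).trans_lt ENNReal.one_lt_top).ne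
  set p : A → ℝ≥0∞ := fun u => ∑ y, margUYZ J (u, y, z) with hp
  have hpt : ∀ u, p u ≠ ∞ := fun u => ENNReal.sum_ne_top.2 fun y _ => PMF.apply_ne_top _ _
  have hpm : ∀ u, p u = ∑ x, margUXZ J (u, x, z) := fun u => sum_margUYZ J u z
  set g : X → ℝ≥0∞ := fun x => ∑' u, p u ^ (a - 1) * margUXZ J (u, x, z) with hg
  have hgB : ∑' x, g x = B := by
    rw [ENNReal.tsum_comm]
    refine tsum_congr fun u => ?_
    rw [ENNReal.tsum_mul_left, tsum_fintype, ← hpm, ennreal_rpow_sub_one_mul_self (hpt u) ha]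
  have hg0 : ∑' x, g x ≠ 0 := by rwa [hgB]
  have hgt : ∑' x, g x ≠ ∞ := by rwa [hgB]
  refine ⟨PMF.normalize g hg0 hgt, ?_, ?_⟩
  · intro x hx
    rw [condX_eq_zero_iff] at hx
    rw [PMF.normalize_apply]
    have : g x = 0 := by
      simp only [hg, h.margUXZ_eq_zero _ hx, mul_zero, tsum_zero]
    rw [this, zero_mul]
  · rw [sibsonSum, Finset.mul_sum]
    refine Finset.sum_le_sum fun y _ => ?_
    rw [← ENNReal.mul_rpow_of_nonneg _ _ (by positivity)]
    refine ENNReal.rpow_le_rpow ?_ (by positivity)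
    have e : B * ∑ x, (PMF.normalize g hg0 hgt) x * condY P z x y ^ a
        = ∑ x, g x * condY P z x y ^ a := by
      rw [Finset.mul_sum]
      refine Finset.sum_congr rfl fun x _ => ?_
      rw [PMF.normalize_apply, hgB, mul_comm (g x), ← mul_assoc, ← mul_assoc,
        ENNReal.mul_inv_cancel hB hBt, one_mul]
    rw [e]
    calc ∑' u, margUYZ J (u, y, z) ^ a
        ≤ ∑' u, p u ^ (a - 1) * ∑ x, margUXZ J (u, x, z) * condY P z x y ^ a := by
          refine ENNReal.tsum_le_tsum fun u => ?_
          rw [h.margUYZ_eq, hpm]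
          exact rpow_sum_mul_le _ _ (by rw [← hpm]; exact hpt u) ha
      _ = ∑' u, ∑ x, p u ^ (a - 1) * margUXZ J (u, x, z) * condY P z x y ^ a := by
          refine tsum_congr fun u => ?_
          rw [Finset.mul_sum]
          exact Finset.sum_congr rfl fun x _ => (mul_assoc _ _ _).symm
      _ = _ := by
          rw [Summable.tsum_finsetSum fun _ _ => ENNReal.summable]
          refine Finset.sum_congr rfl fun x _ => ?_
          rw [ENNReal.tsum_mul_right]

/-- A ratio of sums is at most the largest ratio of its terms, and `Z` is finite, so one state and
its law dominate the leakage. -/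
theorem IsMarkovExtension.condAlphaLeakageReal_le {J : PMF (A × X × Y × Z)}
    {P : PMF (X × Y × Z)} (h : IsMarkovExtension J P) {a : ℝ} (ha : 1 < a) :
    ∃ z ∈ (margZ P).support, ∃ Q : PMF X, AbsContCondX Q P z ∧
      condAlphaLeakageReal (margUYZ J) a ≤ eventSibsonReal P z Q a := by
  classical
  have ha0 : 0 < a := by linarith
  set B : Z → ℝ≥0∞ := fun z => ∑' u, (∑ y, margUYZ J (u, y, z)) ^ a with hB
  have hBt : ∀ z, B z ≠ ∞ := fun z =>
    ((tsum_rpow_le_one (tsum_fst_le_one _ z) ha.le).trans_lt ENNReal.one_lt_top).ne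
  have hterm : ∀ z u y, margUYZ J (u, y, z) ≠ 0 → B z ≠ 0 := by
    intro z u y hne h0
    have h1 := ENNReal.tsum_eq_zero.1 h0 u
    rw [ENNReal.rpow_eq_zero_iff_of_pos ha0, Finset.sum_eq_zero_iff] at h1
    exact hne (h1 y (Finset.mem_univ y))
  have hsupp : ∀ z, B z ≠ 0 → z ∈ (margZ P).support := by
    intro z hz
    rw [PMF.mem_support_iff]
    intro h0
    apply hz
    refine ENNReal.tsum_eq_zero.2 fun u => ?_
    rw [ENNReal.rpow_eq_zero_iff_of_pos ha0, IsMarkovExtension.sum_margUYZ]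
    exact Finset.sum_eq_zero fun x _ => h.margUXZ_eq_zero u (margXZ_eq_zero_of P h0)
  obtain ⟨⟨u₀, y₀, z₀⟩, h₀⟩ := (margUYZ J).support_nonempty
  rw [PMF.mem_support_iff] at h₀
  have : Nonempty X := by
    obtain ⟨⟨x, -⟩⟩ := P.nonempty_type
    exact ⟨x⟩
  have hQ : ∀ z, ∃ Q : PMF X, B z ≠ 0 → AbsContCondX Q P z ∧
      ∑ y, (∑' u, margUYZ J (u, y, z) ^ a) ^ (1 / a) ≤ B z ^ (1 / a) * sibsonSum P z Q a := by
    intro z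
    by_cases hz : B z = 0
    · exact ⟨PMF.pure (Classical.arbitrary X), fun h' => absurd hz h'⟩
    · obtain ⟨Q, hQ⟩ := h.exists_sibsonSum_ge z ha hz
      exact ⟨Q, fun _ => hQ⟩
  choose Q hQ using hQ
  obtain ⟨z, hz, hmax⟩ := Finset.exists_max_image (Finset.univ.filter fun z => B z ≠ 0)
    (fun z => sibsonSum P z (Q z) a) ⟨z₀, by simpa using hterm z₀ u₀ y₀ h₀⟩
  simp only [Finset.mem_filter, Finset.mem_univ, true_and] at hz hmax
  refine ⟨z, hsupp z hz, Q z, (hQ z hz).1, ?_⟩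
  rw [condAlphaLeakageReal_eq_ennreal _ ha, eventSibsonReal]
  have hle : ∑ i : Y × Z, (∑' u, margUYZ J (u, i) ^ a) ^ (1 / a)
      ≤ sibsonSum P z (Q z) a * ∑ z, B z ^ (1 / a) := by
    rw [Fintype.sum_prod_type, Finset.sum_comm, Finset.mul_sum]
    refine Finset.sum_le_sum fun z' _ => ?_
    by_cases hz' : B z' = 0
    · refine le_of_eq_of_le (Finset.sum_eq_zero fun y _ => ?_) zero_le
      have h0 : ∀ u, margUYZ J (u, y, z') = 0 := fun u => by
        by_contra hne
        exact hterm z' u y hne hz'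
      simp [h0, ha0]
    · rw [mul_comm]
      refine (hQ z' hz').2.trans ?_
      gcongr
      exact hmax z' hz'
  have hpos : 0 < a / (a - 1) := div_pos ha0 (by linarith)
  refine mul_le_mul_of_nonneg_left (Real.log_le_log ?_ ?_) hpos.le
  · refine ENNReal.toReal_pos ?_ ?_
    · refine ENNReal.div_ne_zero.2 ⟨?_, ?_⟩
      · intro h0
        rw [Finset.sum_eq_zero_iff] at h0
        have h1 := h0 (y₀, z₀) (Finset.mem_univ _)
        rw [ENNReal.rpow_eq_zero_iff_of_pos (by positivity), ENNReal.tsum_eq_zero] at h1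
        have h2 := h1 u₀
        rw [ENNReal.rpow_eq_zero_iff_of_pos ha0] at h2
        exact h₀ h2
      · exact ENNReal.sum_ne_top.2 fun z _ => ENNReal.rpow_ne_top_of_nonneg (by positivity) (hBt z)
    · exact ((ENNReal.div_le_of_le_mul hle).trans_lt (sibsonSum_ne_top P z _ ha).lt_top).ne
  · exact ENNReal.toReal_mono (sibsonSum_ne_top P z _ ha) (ENNReal.div_le_of_le_mul hle)

end Marginals

/-! ### Sibson and Arimoto quantities: order `∞` and the tilt between them. -/

section EventLimits

theorem tendsto_iSup_of_fintype {X κ : Type*} [Fintype X] [Nonempty X] {l : Filter κ}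
    {g : κ → X → ℝ} {g' : X → ℝ} (h : ∀ x, Tendsto (fun a => g a x) l (𝓝 (g' x))) :
    Tendsto (fun a => ⨆ x, g a x) l (𝓝 (⨆ x, g' x)) := by
  simp only [← Finset.sup'_univ_eq_ciSup]
  exact Tendsto.finset_sup'_nhds_apply _ fun x _ => h x

theorem tendsto_one_div_atTop : Tendsto (fun a : ℝ => 1 / a) atTop (𝓝 0) := by
  simpa using tendsto_inv_atTop_zero (𝕜 := ℝ)

/-- A finite `ℓ^a` norm of a family converging as `a → ∞` tends to the maximum of its limit. -/
theorem tendsto_sum_rpow_atTop {X : Type*} [Fintype X] [Nonempty X] {g : ℝ → X → ℝ} {g' : X → ℝ}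
    (h0 : ∀ a x, 0 ≤ g a x) (h : ∀ x, Tendsto (fun a => g a x) atTop (𝓝 (g' x))) :
    Tendsto (fun a : ℝ => (∑ x, g a x ^ a) ^ (1 / a)) atTop (𝓝 (⨆ x, g' x)) := by
  have hs := tendsto_iSup_of_fintype h
  -- The family moves with `a`, so the squeeze constant is the cardinality of the finite index set.
  have hc : Tendsto (fun a : ℝ => (Fintype.card X : ℝ) ^ (1 / a)) atTop (𝓝 1) := by
    have := (tendsto_const_nhds (x := (Fintype.card X : ℝ))).rpow tendsto_one_div_atTop
      (Or.inl (by simp))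
    simpa using this
  have hu := hc.mul hs
  rw [one_mul] at hu
  refine tendsto_of_tendsto_of_tendsto_of_le_of_le' hs hu ?_ ?_
  · filter_upwards [eventually_gt_atTop 0] with a ha
    refine ciSup_le fun x => ?_
    calc g a x = (g a x ^ a) ^ (1 / a) := by
          rw [← Real.rpow_mul (h0 a x), mul_one_div_cancel ha.ne', Real.rpow_one]
      _ ≤ _ := by
          refine Real.rpow_le_rpow (Real.rpow_nonneg (h0 a x) a) ?_ (by positivity)
          exact Finset.single_le_sum (f := fun x => g a x ^ a)
            (fun x _ => Real.rpow_nonneg (h0 a x) a) (Finset.mem_univ x)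
  · filter_upwards [eventually_gt_atTop 0] with a ha
    have hM : 0 ≤ ⨆ x, g a x := Real.iSup_nonneg (h0 a)
    have hle : ∀ x, g a x ≤ ⨆ x, g a x := fun x => le_ciSup (Set.finite_range _).bddAbove x
    calc (∑ x, g a x ^ a) ^ (1 / a) ≤ (∑ _x : X, (⨆ x, g a x) ^ a) ^ (1 / a) := by
          refine Real.rpow_le_rpow (Finset.sum_nonneg fun x _ => Real.rpow_nonneg (h0 a x) a)
            (Finset.sum_le_sum fun x _ => ?_) (by positivity)
          exact Real.rpow_le_rpow (h0 a x) (hle x) ha.le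
      _ = _ := by
          rw [Finset.sum_const, nsmul_eq_mul, Finset.card_univ,
            Real.mul_rpow (by positivity) (Real.rpow_nonneg hM a), ← Real.rpow_mul hM,
            mul_one_div_cancel ha.ne', Real.rpow_one]

variable {X Y Z : Type*} [Fintype X] [Fintype Y] [Fintype Z]

theorem PMF.nonempty_left {I K : Type*} (P : PMF (I × K)) : Nonempty I := by
  obtain ⟨⟨x, -⟩⟩ := P.nonempty_type
  exact ⟨x⟩

theorem margXZ_ne_zero_of_abs {P : PMF (X × Y × Z)} {Q : PMF X} {z : Z}
    (hQ : AbsContCondX Q P z) {x : X} (hx : Q x ≠ 0) : margXZ P (x, z) ≠ 0 := fun h =>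
  hx (hQ x ((condX_eq_zero_iff P x z).2 h))

theorem sum_condY_toReal {P : PMF (X × Y × Z)} {x : X} {z : Z} (h : margXZ P (x, z) ≠ 0) :
    ∑ y, (condY P z x y).toReal = 1 := by
  rw [← ENNReal.toReal_sum fun y _ => condY_ne_top P x y z, sum_condY P h, ENNReal.toReal_one]

theorem PMF.exists_ne_zero (Q : PMF X) : ∃ x, Q x ≠ 0 := by
  obtain ⟨x, hx⟩ := Q.support_nonempty
  exact ⟨x, (Q.mem_support_iff x).1 hx⟩

/-- A channel row at an input of positive probability sums to one. This keeps the arguments of the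
logarithms away from zero. -/
theorem sum_pos_of_condY_le {P : PMF (X × Y × Z)} {x : X} {z : Z} (h : margXZ P (x, z) ≠ 0)
    {c : ℝ} (hc : 0 < c) {g : Y → ℝ} (hg : ∀ y, c * (condY P z x y).toReal ≤ g y) :
    0 < ∑ y, g y := by
  calc 0 < c := hc
    _ = ∑ y, c * (condY P z x y).toReal := by rw [← Finset.mul_sum, sum_condY_toReal h, mul_one]
    _ ≤ _ := Finset.sum_le_sum fun y _ => hg y

/-- The exponential of the Sibson mutual information of order `∞`. -/
noncomputable def sibsonSup (P : PMF (X × Y × Z)) (z : Z) (Q : PMF X) : ℝ :=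
  ∑ y, ⨆ x, (if Q x = 0 then 0 else 1) * (condY P z x y).toReal

/-- The exponential of the Arimoto mutual information of order `∞`. -/
noncomputable def arimotoSup (P : PMF (X × Y × Z)) (z : Z) (Q : PMF X) : ℝ :=
  ∑ y, (⨆ x, (Q x).toReal * (condY P z x y).toReal) / ⨆ x, (Q x).toReal

theorem sibsonSum_toReal (P : PMF (X × Y × Z)) (z : Z) (Q : PMF X) {a : ℝ} (ha : 1 < a) :
    (sibsonSum P z Q a).toReal
      = ∑ y, (∑ x, (Q x).toReal * (condY P z x y).toReal ^ a) ^ (1 / a) := by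
  have hx : ∀ x y, Q x * condY P z x y ^ a ≠ ∞ := fun x y =>
    ENNReal.mul_ne_top (PMF.apply_ne_top _ _)
      (ENNReal.rpow_ne_top_of_nonneg (by linarith) (condY_ne_top P x y z))
  rw [sibsonSum, ENNReal.toReal_sum fun y _ => ENNReal.rpow_ne_top_of_nonneg
    (by positivity) (ENNReal.sum_ne_top.2 fun x _ => hx x y)]
  refine Finset.sum_congr rfl fun y _ => ?_
  rw [← ENNReal.toReal_rpow, ENNReal.toReal_sum fun x _ => hx x y]
  simp only [ENNReal.toReal_mul, ENNReal.toReal_rpow]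

theorem sibsonSup_pos {P : PMF (X × Y × Z)} {z : Z} {Q : PMF X} (hQ : AbsContCondX Q P z) :
    0 < sibsonSup P z Q := by
  obtain ⟨x, hx⟩ := Q.exists_ne_zero
  refine sum_pos_of_condY_le (margXZ_ne_zero_of_abs hQ hx) one_pos fun y => ?_
  refine le_trans (le_of_eq ?_) (le_ciSup (Set.finite_range _).bddAbove x)
  rw [if_neg hx]

theorem iSup_pmf_pos (Q : PMF X) : 0 < ⨆ x, (Q x).toReal := by
  obtain ⟨x, hx⟩ := exists_toReal_pos Q
  exact hx.trans_le (le_ciSup (f := fun x => (Q x).toReal) (Set.finite_range _).bddAbove x)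

theorem arimotoSup_pos {P : PMF (X × Y × Z)} {z : Z} {Q : PMF X} (hQ : AbsContCondX Q P z) :
    0 < arimotoSup P z Q := by
  obtain ⟨x, hx⟩ := Q.exists_ne_zero
  refine sum_pos_of_condY_le (margXZ_ne_zero_of_abs hQ hx)
    (div_pos (ENNReal.toReal_pos hx (PMF.apply_ne_top _ _)) (iSup_pmf_pos Q)) fun y => ?_
  rw [div_mul_eq_mul_div]
  exact div_le_div_of_nonneg_right (le_ciSup
    (f := fun x => (Q x).toReal * (condY P z x y).toReal) (Set.finite_range _).bddAbove x)
    (iSup_pmf_pos Q).le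

theorem tendsto_eventSibsonReal {P : PMF (X × Y × Z)} {z : Z} {Q : PMF X}
    (hQ : AbsContCondX Q P z) :
    Tendsto (eventSibsonReal P z Q) atTop (𝓝 (Real.log (sibsonSup P z Q))) := by
  have := P.nonempty_left
  have h : Tendsto (fun a : ℝ => (sibsonSum P z Q a).toReal) atTop (𝓝 (sibsonSup P z Q)) := by
    -- The weight moves inside the power as `Q^(1/a)`, which tends to the indicator of the support
    -- of `Q`; only the support matters at order `∞`.
    have h1 : Tendsto (fun a : ℝ => ∑ y,
        (∑ x, ((Q x).toReal ^ (1 / a) * (condY P z x y).toReal) ^ a) ^ (1 / a)) atTop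
        (𝓝 (sibsonSup P z Q)) := by
      refine tendsto_finsetSum _ fun y _ => tendsto_sum_rpow_atTop
        (g' := fun x => (if Q x = 0 then 0 else 1) * (condY P z x y).toReal)
        (fun a x => by positivity) fun x => ?_
      refine Tendsto.mul_const _ ?_
      by_cases hx : Q x = 0
      · rw [if_pos hx, hx, ENNReal.toReal_zero]
        refine tendsto_const_nhds.congr' ?_
        filter_upwards [eventually_gt_atTop 0] with a ha
        rw [Real.zero_rpow (by positivity)]
      · rw [if_neg hx]
        have := (tendsto_const_nhds (x := (Q x).toReal)).rpow tendsto_one_div_atTop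
          (Or.inl (ENNReal.toReal_pos hx (PMF.apply_ne_top _ _)).ne')
        rwa [Real.rpow_zero] at this
    refine h1.congr' ?_
    filter_upwards [eventually_gt_atTop 1] with a ha
    have ha0 : a ≠ 0 := by linarith
    rw [sibsonSum_toReal P z Q ha]
    refine Finset.sum_congr rfl fun y _ => ?_
    congr 1
    refine Finset.sum_congr rfl fun x _ => ?_
    rw [Real.mul_rpow (by positivity) (by positivity), ← Real.rpow_mul (by positivity),
      one_div_mul_cancel ha0, Real.rpow_one]
  have := tendsto_order_div_sub_one.mul (h.log (sibsonSup_pos hQ).ne')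
  rwa [one_mul] at this

theorem sum_rpow_ne_zero (Q : PMF X) {a : ℝ} (ha : 0 < a) : ∑ x, Q x ^ a ≠ 0 := by
  obtain ⟨x, hx⟩ := Q.exists_ne_zero
  intro h
  rw [Finset.sum_eq_zero_iff] at h
  exact hx ((ENNReal.rpow_eq_zero_iff_of_pos ha).1 (h x (Finset.mem_univ x)))

theorem sum_rpow_ne_top (Q : PMF X) {a : ℝ} (ha : 0 < a) : ∑ x, Q x ^ a ≠ ∞ :=
  ENNReal.sum_ne_top.2 fun x _ => ENNReal.rpow_ne_top_of_nonneg ha.le (PMF.apply_ne_top Q x)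

theorem arimotoSum_toReal (P : PMF (X × Y × Z)) (z : Z) (Q : PMF X) {a : ℝ} (ha : 1 < a) :
    (∑ y, ((∑ x, Q x ^ a * condY P z x y ^ a) / (∑ x, Q x ^ a)) ^ (1 / a)).toReal
      = ∑ y, (∑ x, ((Q x).toReal * (condY P z x y).toReal) ^ a) ^ (1 / a)
          / (∑ x, (Q x).toReal ^ a) ^ (1 / a) := by
  have ha0 : 0 < a := by linarith
  have hQt : ∀ x, Q x ^ a ≠ ∞ := fun x =>
    ENNReal.rpow_ne_top_of_nonneg ha0.le (PMF.apply_ne_top Q x)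
  have hx : ∀ x y, Q x ^ a * condY P z x y ^ a ≠ ∞ := fun x y =>
    ENNReal.mul_ne_top (hQt x) (ENNReal.rpow_ne_top_of_nonneg ha0.le (condY_ne_top P x y z))
  rw [ENNReal.toReal_sum fun y _ => ENNReal.rpow_ne_top_of_nonneg (by positivity)
    (ENNReal.div_ne_top (ENNReal.sum_ne_top.2 fun x _ => hx x y) (sum_rpow_ne_zero Q ha0))]
  refine Finset.sum_congr rfl fun y _ => ?_
  rw [← ENNReal.toReal_rpow, ENNReal.toReal_div, ENNReal.toReal_sum fun x _ => hx x y,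
    ENNReal.toReal_sum fun x _ => hQt x, Real.div_rpow
      (Finset.sum_nonneg fun _ _ => ENNReal.toReal_nonneg)
      (Finset.sum_nonneg fun _ _ => ENNReal.toReal_nonneg)]
  simp only [ENNReal.toReal_mul, ← ENNReal.toReal_rpow,
    Real.mul_rpow ENNReal.toReal_nonneg ENNReal.toReal_nonneg]

theorem tendsto_eventArimotoReal {P : PMF (X × Y × Z)} {z : Z} {Q : PMF X}
    (hQ : AbsContCondX Q P z) :
    Tendsto (eventArimotoReal P z Q) atTop (𝓝 (Real.log (arimotoSup P z Q))) := by
  have := P.nonempty_left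
  have h : Tendsto (fun a : ℝ => ∑ y,
      (∑ x, ((Q x).toReal * (condY P z x y).toReal) ^ a) ^ (1 / a)
          / (∑ x, (Q x).toReal ^ a) ^ (1 / a)) atTop (𝓝 (arimotoSup P z Q)) := by
    refine tendsto_finsetSum _ fun y _ => Tendsto.div ?_ ?_ (iSup_pmf_pos Q).ne'
    · exact tendsto_sum_rpow_atTop (fun a x => by positivity) fun x => tendsto_const_nhds
    · exact tendsto_sum_rpow_atTop (fun a x => by positivity) fun x => tendsto_const_nhds
  have h2 := tendsto_order_div_sub_one.mul (h.log (arimotoSup_pos hQ).ne')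
  rw [one_mul] at h2
  refine h2.congr' ?_
  filter_upwards [eventually_gt_atTop 1] with a ha
  rw [eventArimotoReal, arimotoSum_toReal P z Q ha]

theorem eventSibson_top {P : PMF (X × Y × Z)} {z : Z} {Q : PMF X} (hQ : AbsContCondX Q P z) :
    eventSibson P z Q ∞ = Real.log (sibsonSup P z Q) := by
  rw [eventSibson, orderExtension, if_neg ENNReal.top_ne_one, if_pos rfl]
  exact (tendsto_eventSibsonReal hQ).limUnder_eq

theorem eventArimoto_top {P : PMF (X × Y × Z)} {z : Z} {Q : PMF X} (hQ : AbsContCondX Q P z) :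
    eventArimoto P z Q ∞ = Real.log (arimotoSup P z Q) := by
  rw [eventArimoto, orderExtension, if_neg ENNReal.top_ne_one, if_pos rfl]
  exact (tendsto_eventArimotoReal hQ).limUnder_eq

theorem chanSup_toReal (P : PMF (X × Y × Z)) (z : Z) :
    (chanSup P z).toReal = ∑ y, ⨆ x, (condY P z x y).toReal := by
  rw [chanSup, ENNReal.toReal_sum fun y _ =>
    ((iSup_le fun x => condY_le_one P x y z).trans_lt ENNReal.one_lt_top).ne]
  exact Finset.sum_congr rfl fun y _ => ENNReal.toReal_iSup fun x => condY_ne_top P x y z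

theorem sibsonSup_le (P : PMF (X × Y × Z)) (z : Z) (Q : PMF X) :
    sibsonSup P z Q ≤ (chanSup P z).toReal := by
  have := P.nonempty_left
  rw [chanSup_toReal]
  refine Finset.sum_le_sum fun y _ => ciSup_mono (Set.finite_range _).bddAbove fun x => ?_
  split_ifs <;> simp

theorem arimotoSup_le (P : PMF (X × Y × Z)) (z : Z) (Q : PMF X) :
    arimotoSup P z Q ≤ (chanSup P z).toReal := by
  have := P.nonempty_left
  rw [chanSup_toReal]
  refine Finset.sum_le_sum fun y _ => ?_
  rw [div_le_iff₀ (iSup_pmf_pos Q)]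
  refine ciSup_le fun x => ?_
  rw [mul_comm]
  exact mul_le_mul (le_ciSup (f := fun x => (condY P z x y).toReal)
      (Set.finite_range _).bddAbove x)
    (le_ciSup (f := fun x => (Q x).toReal) (Set.finite_range _).bddAbove x)
    ENNReal.toReal_nonneg (Real.iSup_nonneg fun _ => ENNReal.toReal_nonneg)

theorem condY_eq_zero {P : PMF (X × Y × Z)} {x : X} {z : Z} (y : Y)
    (h : margXZ P (x, z) = 0) : condY P z x y = 0 := by
  rw [condY, apply_eq_zero_of_margXZ P y h, ENNReal.zero_div]

theorem exists_margXZ_ne_zero {P : PMF (X × Y × Z)} {z : Z} (hz : z ∈ (margZ P).support) :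
    ∃ x, margXZ P (x, z) ≠ 0 := by
  by_contra! h
  rw [PMF.mem_support_iff, margZ_apply] at hz
  exact hz (Finset.sum_eq_zero fun x _ => h x)

/-- The uniform law on the support of `P_{X|Z=z}` attains the suprema at order `∞`. -/
theorem exists_sup_eq_chanSup {P : PMF (X × Y × Z)} {z : Z} (hz : z ∈ (margZ P).support) :
    ∃ Q : PMF X, AbsContCondX Q P z ∧ sibsonSup P z Q = (chanSup P z).toReal ∧
      arimotoSup P z Q = (chanSup P z).toReal := by
  classical
  set s : Finset X := Finset.univ.filter fun x => margXZ P (x, z) ≠ 0 with hs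
  obtain ⟨x₀, hx₀⟩ := exists_margXZ_ne_zero hz
  have hne : s.Nonempty := ⟨x₀, by simpa [hs] using hx₀⟩
  have := P.nonempty_left
  set Q := PMF.uniformOfFinset s hne with hQ
  have hmem : ∀ x, x ∈ s ↔ margXZ P (x, z) ≠ 0 := by simp [hs]
  have hQ0 : ∀ x, Q x = 0 ↔ margXZ P (x, z) = 0 := by
    intro x
    rw [PMF.uniformOfFinset_apply]
    split_ifs with hx
    · simp [(hmem x).1 hx]
    · simpa using not_not.1 (mt (hmem x).2 hx)
  set c : ℝ := ((s.card : ℝ≥0∞)⁻¹).toReal with hc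
  -- Outside the support the channel value is zero by convention, so the constant `c` can be
  -- factored out for every `x`.
  have hQW : ∀ x y, (Q x).toReal * (condY P z x y).toReal = c * (condY P z x y).toReal := by
    intro x y
    by_cases hx : margXZ P (x, z) = 0
    · rw [condY_eq_zero y hx]; simp
    · rw [PMF.uniformOfFinset_apply, if_pos ((hmem x).2 hx)]
  have hc0 : 0 ≤ c := ENNReal.toReal_nonneg
  have hsup : ⨆ x, (Q x).toReal = c := by
    apply le_antisymm
    · refine ciSup_le fun x => ?_
      rw [PMF.uniformOfFinset_apply]
      split_ifs
      · exact le_rfl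
      · simpa using hc0
    · refine le_trans (le_of_eq ?_) (le_ciSup (f := fun x => (Q x).toReal)
        (Set.finite_range _).bddAbove x₀)
      simp only [hQ]
      rw [PMF.uniformOfFinset_apply, if_pos ((hmem x₀).2 hx₀)]
  have hcpos : 0 < c := hsup ▸ iSup_pmf_pos Q
  refine ⟨Q, fun x hx => (hQ0 x).2 ((condX_eq_zero_iff P x z).1 hx), ?_, ?_⟩
  · rw [chanSup_toReal, sibsonSup]
    refine Finset.sum_congr rfl fun y _ => iSup_congr fun x => ?_
    split_ifs with hx
    · rw [condY_eq_zero y ((hQ0 x).1 hx)]; simp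
    · rw [one_mul]
  · rw [chanSup_toReal, arimotoSup, hsup]
    refine Finset.sum_congr rfl fun y _ => ?_
    simp only [hQW]
    rw [← Real.mul_iSup_of_nonneg hc0, mul_div_cancel_left₀ _ hcpos.ne']

/-- The denominator in Arimoto's expression is the normalising constant of `Q^a`, so the expression
is Sibson's at the tilted law. -/
theorem eventArimotoReal_eq_sibson (P : PMF (X × Y × Z)) (z : Z) (Q Q' : PMF X) {a : ℝ}
    (h : ∀ x, Q' x = Q x ^ a * (∑ x, Q x ^ a)⁻¹) :
    eventArimotoReal P z Q a = eventSibsonReal P z Q' a := by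
  rw [eventArimotoReal, eventSibsonReal]
  congr 4
  ext y
  congr 1
  rw [div_eq_mul_inv, Finset.sum_mul]
  refine Finset.sum_congr rfl fun x _ => ?_
  rw [h]; ring

theorem exists_tilt (Q : PMF X) {a : ℝ} (ha : 0 < a) :
    ∃ Q' : PMF X, ∀ x, Q' x = Q x ^ a * (∑ x, Q x ^ a)⁻¹ := by
  have e : ∑' x, Q x ^ a = ∑ x, Q x ^ a := tsum_fintype _
  refine ⟨PMF.normalize (fun x => Q x ^ a) (by rw [e]; exact sum_rpow_ne_zero Q ha)
    (by rw [e]; exact sum_rpow_ne_top Q ha), fun x => ?_⟩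
  rw [PMF.normalize_apply, e]

/-- The exponents `1/a` and `a` cancel, and the remaining constant is removed by renormalising;
hence every law is a tilt. -/
theorem tilt_inverse {Q Q' : PMF X} {a : ℝ} (ha : 0 < a)
    (h : ∀ x, Q' x = Q x ^ (1 / a) * (∑ x, Q x ^ (1 / a))⁻¹) :
    ∀ x, Q x = Q' x ^ a * (∑ x, Q' x ^ a)⁻¹ := by
  have ha1 : 0 < 1 / a := by positivity
  set c := (∑ x, Q x ^ (1 / a))⁻¹ with hc
  have hc0 : c ≠ 0 := ENNReal.inv_ne_zero.2 (sum_rpow_ne_top Q ha1)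
  have hct : c ≠ ∞ := ENNReal.inv_ne_top.2 (sum_rpow_ne_zero Q ha1)
  have hca0 : c ^ a ≠ 0 := by simp [ENNReal.rpow_eq_zero_iff_of_pos ha, hc0]
  have hcat : c ^ a ≠ ∞ := ENNReal.rpow_ne_top_of_nonneg ha.le hct
  have h1 : ∀ x, Q' x ^ a = Q x * c ^ a := fun x => by
    rw [h, ENNReal.mul_rpow_of_nonneg _ _ ha.le, ← ENNReal.rpow_mul, one_div_mul_cancel ha.ne',
      ENNReal.rpow_one]
  intro x
  simp only [h1]
  rw [← Finset.sum_mul, ← tsum_fintype (L := .unconditional _), Q.tsum_coe, one_mul, mul_assoc,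
    ENNReal.mul_inv_cancel hca0 hcat, mul_one]

/-- Tilting preserves zeros, hence absolute continuity. -/
theorem exists_sibson_eq_arimoto {P : PMF (X × Y × Z)} {z : Z} {Q : PMF X}
    (hQ : AbsContCondX Q P z) {a : ℝ} (ha : 0 < a) :
    ∃ Q' : PMF X, AbsContCondX Q' P z ∧ eventArimotoReal P z Q a = eventSibsonReal P z Q' a := by
  obtain ⟨Q', h⟩ := exists_tilt Q ha
  exact ⟨Q', fun x hx => by rw [h, hQ x hx, ENNReal.zero_rpow_of_pos ha, zero_mul],
    eventArimotoReal_eq_sibson P z Q Q' h⟩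

theorem exists_arimoto_eq_sibson {P : PMF (X × Y × Z)} {z : Z} {Q : PMF X}
    (hQ : AbsContCondX Q P z) {a : ℝ} (ha : 0 < a) :
    ∃ Q' : PMF X, AbsContCondX Q' P z ∧ eventSibsonReal P z Q a = eventArimotoReal P z Q' a := by
  obtain ⟨Q', h⟩ := exists_tilt Q (a := 1 / a) (by positivity)
  refine ⟨Q', fun x hx => ?_, (eventArimotoReal_eq_sibson P z Q' Q (tilt_inverse ha h)).symm⟩
  rw [h, hQ x hx, ENNReal.zero_rpow_of_pos (by positivity), zero_mul]

theorem sibsonSum_toReal_pos {P : PMF (X × Y × Z)} {z : Z} {Q : PMF X}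
    (hQ : AbsContCondX Q P z) {a : ℝ} (ha : 1 < a) : 0 < (sibsonSum P z Q a).toReal := by
  obtain ⟨x, hx⟩ := exists_toReal_pos Q
  have ha0 : 0 < a := by linarith
  have hx' : Q x ≠ 0 := fun h => by simp [h] at hx
  rw [sibsonSum_toReal P z Q ha]
  refine sum_pos_of_condY_le (margXZ_ne_zero_of_abs hQ hx')
    (Real.rpow_pos_of_pos hx (1 / a)) fun y => ?_
  calc _ = ((Q x).toReal * (condY P z x y).toReal ^ a) ^ (1 / a) := by
        rw [Real.mul_rpow (by positivity) (by positivity), ← Real.rpow_mul (by positivity),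
          mul_one_div_cancel ha0.ne', Real.rpow_one]
    _ ≤ _ := by
        refine Real.rpow_le_rpow (by positivity) ?_ (by positivity)
        exact Finset.single_le_sum (f := fun x => (Q x).toReal * (condY P z x y).toReal ^ a)
          (fun x _ => by positivity) (Finset.mem_univ x)

theorem eventSibsonReal_le_chanSup {P : PMF (X × Y × Z)} {z : Z} {Q : PMF X}
    (hQ : AbsContCondX Q P z) {a : ℝ} (ha : 1 < a) :
    eventSibsonReal P z Q a ≤ a / (a - 1) * Real.log (chanSup P z).toReal := by
  refine mul_le_mul_of_nonneg_left ?_ (div_pos (by linarith) (by linarith)).le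
  exact Real.log_le_log (sibsonSum_toReal_pos hQ ha)
    (ENNReal.toReal_mono (chanSup_ne_top P z) (sibsonSum_le_chanSup P z Q ha))

end EventLimits

/-! ### Shattering `X`: the lower bound. -/

section Extensions

variable {A X Y Z : Type*} [Fintype X] [Fintype Y] [Fintype Z]

/-- The joint law of `(U, X, Y, Z)` where `U` is drawn from `(X, Z)` by the kernel `κ`. -/
noncomputable def kernelExtension (P : PMF (X × Y × Z)) (κ : X × Z → PMF A) :
    PMF (A × X × Y × Z) :=
  P.bind fun w => (κ (w.1, w.2.2)).map fun u => (u, w)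

theorem kernelExtension_apply (P : PMF (X × Y × Z)) (κ : X × Z → PMF A) (u : A) (x : X) (y : Y)
    (z : Z) : kernelExtension P κ (u, x, y, z) = κ (x, z) u * P (x, y, z) := by
  classical
  rw [kernelExtension, PMF.bind_apply, tsum_eq_single (x, y, z)]
  · rw [mul_comm, PMF.map_apply_eq_tsum _ _ _ (fun _ : Unit => u), tsum_fintype]
    · simp
    · intro _ _ _; rfl
    · intro _; rfl
    · intro v hv
      exact ⟨(), (congrArg Prod.fst hv).symm⟩
  · intro w hw
    rw [mul_eq_zero]
    right
    rw [PMF.map_apply, ENNReal.tsum_eq_zero]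
    intro v
    rw [if_neg]
    intro h
    exact hw (congrArg Prod.snd h).symm

theorem isMarkovExtension_kernelExtension (P : PMF (X × Y × Z)) (κ : X × Z → PMF A) :
    IsMarkovExtension (kernelExtension P κ) P where
  marginal := by
    ext ⟨x, y, z⟩
    rw [map_snd_apply]
    simp only [kernelExtension_apply]
    rw [ENNReal.tsum_mul_right, PMF.tsum_coe, one_mul]
  markov u x y z := by
    rw [margUXZ_apply, margXZ_apply]
    simp only [kernelExtension_apply]
    rw [← Finset.mul_sum]
    ring

/-- The kernel that splits the letter `x` in state `z` uniformly into `n (x, z)` letters. -/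
noncomputable def shatterKernel (e : X × ℕ ≃ A) (n : X × Z → ℕ) (hn : ∀ i, 0 < n i) :
    X × Z → PMF A := fun i =>
  (PMF.uniformOfFinset (Finset.range (n i)) (Finset.nonempty_range_iff.2 (hn i).ne')).map
    fun k => e (i.1, k)

theorem shatterKernel_apply [DecidableEq X] (e : X × ℕ ≃ A) (n : X × Z → ℕ) (hn : ∀ i, 0 < n i)
    (x x' : X) (z : Z) (k : ℕ) :
    shatterKernel e n hn (x, z) (e (x', k))
      = if x = x' then (if k < n (x, z) then (n (x, z) : ℝ≥0∞)⁻¹ else 0) else 0 := by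
  classical
  rw [shatterKernel]
  split_ifs with h1 h2
  · subst h1
    rw [PMF.map_apply_eq_tsum _ _ _ (fun _ : Unit => k), tsum_fintype]
    · simp [PMF.uniformOfFinset_apply, h2]
    · intro _ _ _; rfl
    · intro _; rfl
    · intro v hv
      exact ⟨(), by simpa using hv.symm⟩
  · subst h1
    rw [PMF.map_apply_eq_tsum _ _ _ (fun _ : Unit => k), tsum_fintype]
    · simp [PMF.uniformOfFinset_apply, h2]
    · intro _ _ _; rfl
    · intro _; rfl
    · intro v hv
      exact ⟨(), by simpa using hv.symm⟩
  · rw [PMF.map_apply, ENNReal.tsum_eq_zero]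
    intro v
    rw [if_neg]
    intro h
    exact h1 (congrArg Prod.fst (e.injective h)).symm

theorem margUYZ_shatter (P : PMF (X × Y × Z)) (e : X × ℕ ≃ A) (n : X × Z → ℕ)
    (hn : ∀ i, 0 < n i) (x : X) (k : ℕ) (y : Y) (z : Z) :
    (margUYZ (kernelExtension P (shatterKernel e n hn)) (e (x, k), y, z)).toReal
      = if k < n (x, z) then (P (x, y, z)).toReal / n (x, z) else 0 := by
  classical
  rw [margUYZ_apply]
  simp only [kernelExtension_apply, shatterKernel_apply]
  simp only [ite_mul, zero_mul, Finset.sum_ite_eq', Finset.mem_univ, if_true]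
  split_ifs
  · rw [ENNReal.toReal_mul, ENNReal.toReal_inv, ENNReal.toReal_natCast]
    ring
  · simp

/-- A mass `g` cut into `n` equal pieces contributes `n (g/n)^a = n^(1-a) g^a`. One alphabet `X × ℕ`
serves all multiplicities, the surplus letters having mass zero. -/
theorem tsum_shatter_rpow (e : X × ℕ ≃ A) {f : A → ℝ} (h0 : ∀ u, 0 ≤ f u) (h1 : ∀ u, f u ≤ 1)
    (hf : Summable f) {n : X → ℕ} (hn : ∀ x, 0 < n x) {g : X → ℝ}
    (hg0 : ∀ x, 0 ≤ g x) (hg : ∀ x k, f (e (x, k)) = if k < n x then g x / n x else 0)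
    {a : ℝ} (ha : 1 < a) :
    ∑' u, f u ^ a = ∑ x, (n x : ℝ) ^ (1 - a) * g x ^ a := by
  have hs := (summable_rpow_of_le_one h0 h1 hf ha.le)
  have hs' : Summable fun i => f (e i) ^ a := (e.summable_iff (f := fun u => f u ^ a)).2 hs
  rw [← e.tsum_eq, hs'.tsum_prod, tsum_fintype]
  refine Finset.sum_congr rfl fun x _ => ?_
  have hnx : (0 : ℝ) < n x := Nat.cast_pos.2 (hn x)
  rw [tsum_eq_sum (s := Finset.range (n x))]
  · rw [Finset.sum_congr rfl (g := fun _ => (g x / n x) ^ a)]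
    · rw [Finset.sum_const, Finset.card_range, nsmul_eq_mul, Real.div_rpow (hg0 x) hnx.le,
        Real.rpow_sub hnx, Real.rpow_one]
      ring
    · intro k hk
      rw [hg, if_pos (Finset.mem_range.1 hk)]
  · intro k hk
    rw [hg, if_neg (mt Finset.mem_range.2 hk), Real.zero_rpow (by linarith)]

theorem iSup_shatter (e : X × ℕ ≃ A) {f : A → ℝ} (h1 : ∀ u, f u ≤ 1) {n : X → ℕ}
    (hn : ∀ x, 0 < n x) {g : X → ℝ}
    (hg0 : ∀ x, 0 ≤ g x) (hg : ∀ x k, f (e (x, k)) = if k < n x then g x / n x else 0) :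
    ⨆ u, f u = ⨆ x, (n x : ℝ)⁻¹ * g x := by
  have hb : BddAbove (Set.range fun x => (n x : ℝ)⁻¹ * g x) := (Set.finite_range _).bddAbove
  have hpos : ∀ x, 0 ≤ (n x : ℝ)⁻¹ * g x := fun x => mul_nonneg (by positivity) (hg0 x)
  apply le_antisymm
  · refine Real.iSup_le (fun u => ?_) (Real.iSup_nonneg hpos)
    obtain ⟨⟨x, k⟩, rfl⟩ := e.surjective u
    rw [hg]
    split_ifs
    · rw [div_eq_inv_mul]
      exact le_ciSup hb x
    · exact Real.iSup_nonneg hpos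
  · have hfb : BddAbove (Set.range f) := ⟨1, by rintro _ ⟨u, rfl⟩; exact h1 u⟩
    have h0 : ∀ u, 0 ≤ f u := by
      intro u
      obtain ⟨⟨x, k⟩, rfl⟩ := e.surjective u
      rw [hg]
      split_ifs
      · exact div_nonneg (hg0 x) (Nat.cast_nonneg _)
      · exact le_rfl
    refine Real.iSup_le (fun x => ?_) (Real.iSup_nonneg h0)
    have := le_ciSup hfb (e (x, 0))
    rwa [hg, if_pos (hn x), div_eq_inv_mul] at this

theorem margXZ_toReal (P : PMF (X × Y × Z)) (x : X) (z : Z) :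
    (margXZ P (x, z)).toReal = ∑ y, (P (x, y, z)).toReal := by
  rw [margXZ_apply, ENNReal.toReal_sum fun y _ => PMF.apply_ne_top P _]

theorem sum_margUYZ_shatter (P : PMF (X × Y × Z)) (e : X × ℕ ≃ A) (n : X × Z → ℕ)
    (hn : ∀ i, 0 < n i) (x : X) (k : ℕ) (z : Z) :
    ∑ y, (margUYZ (kernelExtension P (shatterKernel e n hn)) (e (x, k), y, z)).toReal
      = if k < n (x, z) then (margXZ P (x, z)).toReal / n (x, z) else 0 := by
  simp only [margUYZ_shatter]
  split_ifs
  · rw [margXZ_toReal, Finset.sum_div]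
  · simp

/-- The ratio defining the leakage of a shattered version of `X` at order `a`, as a function of
the weights that the shattering puts on the pairs `(x, z)`. -/
noncomputable def weightedRatio (P : PMF (X × Y × Z)) (a : ℝ) (ρ : X × Z → ℝ) : ℝ :=
  (∑ i : Y × Z, (∑ x, ρ (x, i.2) * (P (x, i)).toReal ^ a) ^ (1 / a)) /
    ∑ z, (∑ x, ρ (x, z) * (margXZ P (x, z)).toReal ^ a) ^ (1 / a)

/-- The analogue of `weightedRatio` at order `∞`. -/
noncomputable def weightedSupRatio (P : PMF (X × Y × Z)) (ρ : X × Z → ℝ) : ℝ :=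
  (∑ i : Y × Z, ⨆ x, ρ (x, i.2) * (P (x, i)).toReal) /
    ∑ z, ⨆ x, ρ (x, z) * (margXZ P (x, z)).toReal

theorem condAlphaLeakageReal_shatter (P : PMF (X × Y × Z)) (e : X × ℕ ≃ A) (n : X × Z → ℕ)
    (hn : ∀ i, 0 < n i) {a : ℝ} (ha : 1 < a) :
    condAlphaLeakageReal (margUYZ (kernelExtension P (shatterKernel e n hn))) a
      = a / (a - 1) * Real.log (weightedRatio P a fun i => (n i : ℝ) ^ (1 - a)) := by
  rw [condAlphaLeakageReal_eq _ ha, weightedRatio]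
  congr 3
  · refine Finset.sum_congr rfl fun i _ => ?_
    obtain ⟨y, z⟩ := i
    rw [tsum_shatter_rpow e (fun _ => ENNReal.toReal_nonneg) (fun _ => PMF.toReal_le_one _ _)
      (summable_left_toReal _ _) (n := fun x => n (x, z)) (fun x => hn _)
      (g := fun x => (P (x, y, z)).toReal) (fun _ => ENNReal.toReal_nonneg)
      (fun x k => margUYZ_shatter P e n hn x k y z) ha]
  · refine Finset.sum_congr rfl fun z _ => ?_
    rw [tsum_shatter_rpow e (fun _ => Finset.sum_nonneg fun _ _ => ENNReal.toReal_nonneg)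
      (fun _ => sum_toReal_le_one _ z _)
      (summable_sum_toReal _ z) (n := fun x => n (x, z)) (fun x => hn _)
      (g := fun x => (margXZ P (x, z)).toReal) (fun _ => ENNReal.toReal_nonneg)
      (fun x k => sum_margUYZ_shatter P e n hn x k z) ha]

theorem supRatio_shatter (P : PMF (X × Y × Z)) (e : X × ℕ ≃ A) (n : X × Z → ℕ)
    (hn : ∀ i, 0 < n i) :
    supRatio (margUYZ (kernelExtension P (shatterKernel e n hn)))
      = weightedSupRatio P fun i => (n i : ℝ)⁻¹ := by
  rw [supRatio, weightedSupRatio]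
  congr 1
  · refine Finset.sum_congr rfl fun i _ => ?_
    obtain ⟨y, z⟩ := i
    exact iSup_shatter e (fun _ => PMF.toReal_le_one _ _) (n := fun x => n (x, z)) (fun x => hn _)
      (g := fun x => (P (x, y, z)).toReal) (fun _ => ENNReal.toReal_nonneg)
      (fun x k => margUYZ_shatter P e n hn x k y z)
  · refine Finset.sum_congr rfl fun z _ => ?_
    exact iSup_shatter e (fun _ => sum_toReal_le_one _ z _) (n := fun x => n (x, z))
      (fun x => hn _) (g := fun x => (margXZ P (x, z)).toReal) (fun _ => ENNReal.toReal_nonneg)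
      (fun x k => sum_margUYZ_shatter P e n hn x k z)

/-- Numerator and denominator are homogeneous of degree `1/a` in the weights. Integer multiplicities
only give weights `n^(1-a)` of at most one; rescaling frees them from this restriction. -/
theorem weightedRatio_smul (P : PMF (X × Y × Z)) (a : ℝ) {ρ : X × Z → ℝ}
    (hρ : ∀ i, 0 ≤ ρ i) {t : ℝ} (ht : 0 < t) :
    weightedRatio P a (fun i => t * ρ i) = weightedRatio P a ρ := by
  have key : ∀ (r g : X → ℝ), (∀ x, 0 ≤ r x) → (∀ x, 0 ≤ g x) →
      (∑ x, t * r x * g x) ^ (1 / a) = t ^ (1 / a) * (∑ x, r x * g x) ^ (1 / a) := by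
    intro r g hr hg
    rw [← Real.mul_rpow ht.le (Finset.sum_nonneg fun x _ => mul_nonneg (hr x) (hg x)),
      Finset.mul_sum]
    simp only [mul_assoc]
  have hp : 0 < t ^ (1 / a) := Real.rpow_pos_of_pos ht _
  rw [weightedRatio, weightedRatio]
  rw [Finset.sum_congr rfl fun (i : Y × Z) _ => key (fun x => ρ (x, i.2))
      (fun x => (P (x, i)).toReal ^ a) (fun x => hρ _) (fun x => by positivity),
    Finset.sum_congr rfl fun z _ => key (fun x => ρ (x, z))
      (fun x => (margXZ P (x, z)).toReal ^ a) (fun x => hρ _) (fun x => by positivity),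
    ← Finset.mul_sum, ← Finset.mul_sum, mul_div_mul_left _ _ hp.ne']

theorem weightedSupRatio_smul (P : PMF (X × Y × Z)) (ρ : X × Z → ℝ) {t : ℝ} (ht : 0 < t) :
    weightedSupRatio P (fun i => t * ρ i) = weightedSupRatio P ρ := by
  simp only [weightedSupRatio, mul_assoc]
  simp only [← Real.mul_iSup_of_nonneg ht.le, ← Finset.mul_sum]
  rw [mul_div_mul_left _ _ ht.ne']

theorem tendsto_weightedRatio (P : PMF (X × Y × Z)) {a : ℝ} (ha : 1 < a) {ρ : ℕ → X × Z → ℝ}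
    {ρ' : X × Z → ℝ} (h : ∀ i, Tendsto (fun k => ρ k i) atTop (𝓝 (ρ' i)))
    (h0 : ∑ z, (∑ x, ρ' (x, z) * (margXZ P (x, z)).toReal ^ a) ^ (1 / a) ≠ 0) :
    Tendsto (fun k => weightedRatio P a (ρ k)) atTop (𝓝 (weightedRatio P a ρ')) := by
  have ha0 : 0 < 1 / a := by positivity
  refine Tendsto.div ?_ ?_ h0
  · refine tendsto_finsetSum _ fun i _ => Tendsto.rpow_const ?_ (Or.inr ha0.le)
    exact tendsto_finsetSum _ fun x _ => (h _).mul_const _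
  · refine tendsto_finsetSum _ fun i _ => Tendsto.rpow_const ?_ (Or.inr ha0.le)
    exact tendsto_finsetSum _ fun x _ => (h _).mul_const _

theorem tendsto_weightedSupRatio (P : PMF (X × Y × Z)) {ρ : ℕ → X × Z → ℝ}
    {ρ' : X × Z → ℝ} (h : ∀ i, Tendsto (fun k => ρ k i) atTop (𝓝 (ρ' i)))
    (h0 : ∑ z, ⨆ x, ρ' (x, z) * (margXZ P (x, z)).toReal ≠ 0) :
    Tendsto (fun k => weightedSupRatio P (ρ k)) atTop (𝓝 (weightedSupRatio P ρ')) := by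
  have := P.nonempty_left
  refine Tendsto.div ?_ ?_ h0
  · exact tendsto_finsetSum _ fun i _ => tendsto_iSup_of_fintype fun x => (h _).mul_const _
  · exact tendsto_finsetSum _ fun z _ => tendsto_iSup_of_fintype fun x => (h _).mul_const _

/-- Every nonnegative weight is a limit of renormalized powers `n ^ (-s)` of multiplicities. -/
theorem exists_multiplicities {s : ℝ} (hs : 0 < s) {r : ℝ} (hr : 0 ≤ r) :
    ∃ n : ℕ → ℕ, (∀ k, 0 < n k) ∧
      Tendsto (fun k : ℕ => ((k : ℝ) + 1) ^ s * (n k : ℝ) ^ (-s)) atTop (𝓝 r) := by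
  have hk : ∀ k : ℕ, (0 : ℝ) < (k : ℝ) + 1 := fun k => by positivity
  have key : ∀ (n : ℕ → ℕ) (k : ℕ), ((k : ℝ) + 1) ^ s * (n k : ℝ) ^ (-s)
      = ((n k : ℝ) / ((k : ℝ) + 1)) ^ (-s) := by
    intro n k
    rw [Real.div_rpow (Nat.cast_nonneg _) (hk k).le, Real.rpow_neg (hk k).le, div_inv_eq_mul,
      mul_comm]
  have hinf : Tendsto (fun k : ℕ => (k : ℝ) + 1) atTop atTop :=
    tendsto_atTop_add_const_right _ _ tendsto_natCast_atTop_atTop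
  rcases hr.eq_or_lt with h | h
  -- For `r = 0` the multiplicity must outgrow the scale `k + 1`.
  · refine ⟨fun k => (k + 1) * (k + 1), fun k => by positivity,
      Tendsto.congr (fun k => (key (fun k => (k + 1) * (k + 1)) k).symm) ?_⟩
    rw [← h]
    refine ((tendsto_rpow_neg_atTop hs).comp hinf).congr fun k => ?_
    simp only [Function.comp]
    congr 1
    have := (hk k).ne'
    push_cast
    field_simp
  -- `c` solves `c^(-s) = r`, so the multiplicities should grow like `c (k+1)`; the added one keeps
  -- them positive.
  · set c : ℝ := r ^ (-s⁻¹) with hc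
    have hcpos : 0 < c := Real.rpow_pos_of_pos h _
    refine ⟨fun k => ⌊c * ((k : ℝ) + 1)⌋₊ + 1, fun k => Nat.succ_pos _,
      Tendsto.congr (fun k => (key (fun k => ⌊c * ((k : ℝ) + 1)⌋₊ + 1) k).symm) ?_⟩
    have h1 : Tendsto (fun k : ℕ => ((⌊c * ((k : ℝ) + 1)⌋₊ : ℝ)) / ((k : ℝ) + 1)) atTop (𝓝 c) :=
      (tendsto_nat_floor_mul_div_atTop hcpos.le).comp hinf
    have h2 : Tendsto (fun k : ℕ => ((⌊c * ((k : ℝ) + 1)⌋₊ + 1 : ℕ) : ℝ) / ((k : ℝ) + 1)) atTop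
        (𝓝 c) := by
      have h3 := h1.add (tendsto_inv_atTop_zero.comp hinf)
      rw [add_zero] at h3
      refine h3.congr fun k => ?_
      simp only [Function.comp]
      push_cast
      ring
    have h4 := h2.rpow_const (p := -s) (Or.inl hcpos.ne')
    have h5 : c ^ (-s) = r := by
      rw [hc, ← Real.rpow_mul h.le, neg_mul_neg, inv_mul_cancel₀ hs.ne', Real.rpow_one]
    rwa [h5] at h4

theorem exists_multiplicities_family {I : Type*} {s : ℝ} (hs : 0 < s) {r : I → ℝ}
    (hr : ∀ i, 0 ≤ r i) : ∃ n : ℕ → I → ℕ, (∀ k i, 0 < n k i) ∧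
      ∀ i, Tendsto (fun k : ℕ => ((k : ℝ) + 1) ^ s * (n k i : ℝ) ^ (-s)) atTop (𝓝 (r i)) := by
  choose n hn hlim using fun i => exists_multiplicities hs (hr i)
  exact ⟨fun k i => n i k, fun k i => hn i k, hlim⟩

theorem condY_toReal (P : PMF (X × Y × Z)) (x : X) (y : Y) (z : Z) :
    (condY P z x y).toReal = (P (x, y, z)).toReal / (margXZ P (x, z)).toReal := by
  rw [condY, ENNReal.toReal_div]

/-- Shattered versions of `X` realize the event-conditional Sibson mutual information. -/
theorem exists_tendsto_sibson (P : PMF (X × Y × Z)) (e : X × ℕ ≃ A) {z : Z} {Q : PMF X}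
    (hQ : AbsContCondX Q P z) {a : ℝ} (ha : 1 < a) :
    ∃ J : ℕ → PMF (A × X × Y × Z), (∀ k, IsMarkovExtension (J k) P) ∧
      Tendsto (fun k => condAlphaLeakageReal (margUYZ (J k)) a) atTop
        (𝓝 (eventSibsonReal P z Q a)) := by
  classical
  have ha0 : 0 < a := by linarith
  -- Dividing by `P(x,z)^a` turns the denominator into the total mass of `Q` and the numerator into
  -- the Sibson sum. Weight zero removes all other states in the limit.
  set ρ : X × Z → ℝ := fun i => if i.2 = z then
    (Q i.1).toReal / (margXZ P (i.1, z)).toReal ^ a else 0 with hρ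
  have hρ0 : ∀ i, 0 ≤ ρ i := fun i => by
    simp only [hρ]
    split_ifs <;> positivity
  obtain ⟨n, hn, hlim⟩ := exists_multiplicities_family (s := a - 1) (by linarith) hρ0
  refine ⟨fun k => kernelExtension P (shatterKernel e (n k) (hn k)),
    fun k => isMarkovExtension_kernelExtension P _, ?_⟩
  have hD : ∑ z', (∑ x, ρ (x, z') * (margXZ P (x, z')).toReal ^ a) ^ (1 / a) = 1 := by
    rw [Finset.sum_eq_single z]
    · have e1 : ∀ x, ρ (x, z) * (margXZ P (x, z)).toReal ^ a = (Q x).toReal := by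
        intro x
        simp only [hρ, if_true]
        by_cases hx : Q x = 0
        · simp [hx]
        · have h1 := ENNReal.toReal_pos (margXZ_ne_zero_of_abs hQ hx) (PMF.apply_ne_top _ _)
          have h2 := Real.rpow_pos_of_pos h1 a
          field_simp
      simp only [e1]
      rw [← ENNReal.toReal_sum fun x _ => PMF.apply_ne_top Q x,
        ← tsum_fintype (L := .unconditional _), Q.tsum_coe, ENNReal.toReal_one, Real.one_rpow]
    · intro z' _ hz'
      simp [hρ, hz', ha0.ne']
    · intro h; exact absurd (Finset.mem_univ z) h
  have hN : ∑ i : Y × Z, (∑ x, ρ (x, i.2) * (P (x, i)).toReal ^ a) ^ (1 / a)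
      = (sibsonSum P z Q a).toReal := by
    rw [sibsonSum_toReal P z Q ha, Fintype.sum_prod_type]
    refine Finset.sum_congr rfl fun y _ => ?_
    rw [Finset.sum_eq_single z]
    · congr 1
      refine Finset.sum_congr rfl fun x _ => ?_
      simp only [hρ, if_true]
      rw [condY_toReal, Real.div_rpow ENNReal.toReal_nonneg ENNReal.toReal_nonneg]
      ring
    · intro z' _ hz'
      simp [hρ, hz', ha0.ne']
    · intro h; exact absurd (Finset.mem_univ z) h
  have hR : weightedRatio P a ρ = (sibsonSum P z Q a).toReal := by
    rw [weightedRatio, hD, hN, div_one]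
  have ht := tendsto_weightedRatio P ha hlim (by rw [hD]; exact one_ne_zero)
  rw [hR] at ht
  have hl := (ht.log (sibsonSum_toReal_pos hQ ha).ne').const_mul (a / (a - 1))
  refine hl.congr fun k => ?_
  rw [condAlphaLeakageReal_shatter P e (n k) (hn k) ha, weightedRatio_smul P a
    (fun i => by positivity) (by positivity)]
  simp only [neg_sub]

theorem chanSup_toReal_pos {P : PMF (X × Y × Z)} {z : Z} (hz : z ∈ (margZ P).support) :
    0 < (chanSup P z).toReal := by
  obtain ⟨Q, hQ, h, -⟩ := exists_sup_eq_chanSup hz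
  exact h ▸ sibsonSup_pos hQ

/-- Shattered versions of `X` realize the largest leakage of order `∞` in a given state. -/
theorem exists_tendsto_chanSup (P : PMF (X × Y × Z)) (e : X × ℕ ≃ A) {z : Z}
    (hz : z ∈ (margZ P).support) :
    ∃ J : ℕ → PMF (A × X × Y × Z), (∀ k, IsMarkovExtension (J k) P) ∧
      Tendsto (fun k => condAlphaLeakage (margUYZ (J k)) ∞) atTop
        (𝓝 (Real.log (chanSup P z).toReal)) := by
  classical
  have hne := P.nonempty_left
  -- At order `∞` the pieces have weight `n⁻¹`, so the target is `1/P(x,z)`: the denominator becomes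
  -- one and the numerator the sum of column maxima. Inputs of probability zero get weight zero
  -- since `0⁻¹ = 0`.
  set ρ : X × Z → ℝ := fun i => if i.2 = z then ((margXZ P (i.1, z)).toReal)⁻¹ else 0 with hρ
  have hρ0 : ∀ i, 0 ≤ ρ i := fun i => by
    simp only [hρ]
    split_ifs <;> positivity
  obtain ⟨n, hn, hlim⟩ := exists_multiplicities_family (s := 1) one_pos hρ0
  refine ⟨fun k => kernelExtension P (shatterKernel e (n k) (hn k)),
    fun k => isMarkovExtension_kernelExtension P _, ?_⟩
  have hD : ∑ z', ⨆ x, ρ (x, z') * (margXZ P (x, z')).toReal = 1 := by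
    rw [Finset.sum_eq_single z]
    · obtain ⟨x₀, hx₀⟩ := exists_margXZ_ne_zero hz
      have h1 := ENNReal.toReal_pos hx₀ (PMF.apply_ne_top _ _)
      simp only [hρ, if_true]
      apply le_antisymm
      · exact ciSup_le fun x => inv_mul_le_one
      · refine le_trans (le_of_eq ?_) (le_ciSup (Set.finite_range _).bddAbove x₀)
        exact (inv_mul_cancel₀ h1.ne').symm
    · intro z' _ hz'
      simp [hρ, hz']
    · intro h; exact absurd (Finset.mem_univ z) h
  have hN : ∑ i : Y × Z, ⨆ x, ρ (x, i.2) * (P (x, i)).toReal = (chanSup P z).toReal := by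
    rw [chanSup_toReal, Fintype.sum_prod_type]
    refine Finset.sum_congr rfl fun y _ => ?_
    rw [Finset.sum_eq_single z]
    · refine iSup_congr fun x => ?_
      simp only [hρ, if_true]
      rw [condY_toReal]
      ring
    · intro z' _ hz'
      simp [hρ, hz']
    · intro h; exact absurd (Finset.mem_univ z) h
  have hR : weightedSupRatio P ρ = (chanSup P z).toReal := by
    rw [weightedSupRatio, hD, hN, div_one]
  have ht := tendsto_weightedSupRatio P hlim (by rw [hD]; exact one_ne_zero)
  rw [hR] at ht
  refine (ht.log (chanSup_toReal_pos hz).ne').congr fun k => ?_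
  rw [condAlphaLeakage_top, supRatio_shatter P e (n k) (hn k),
    weightedSupRatio_smul P _ (by positivity)]
  simp only [Real.rpow_neg_one]

end Extensions

/-! ### Order one: data processing for conditional mutual information. -/

section OrderOne

variable {A X Y Z : Type*} [Fintype X] [Fintype Y] [Fintype Z]

theorem margYZ_toReal (P : PMF (X × Y × Z)) (y : Y) (z : Z) :
    (margYZ P (y, z)).toReal = ∑ x, (P (x, y, z)).toReal := by
  rw [margYZ_apply, ENNReal.toReal_sum fun y _ => PMF.apply_ne_top P _]

theorem margZ_toReal (P : PMF (X × Y × Z)) (z : Z) :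
    (margZ P z).toReal = ∑ y, (margYZ P (y, z)).toReal := by
  rw [margZ_apply, ENNReal.toReal_sum fun y _ => PMF.apply_ne_top _ _]
  simp only [margXZ_toReal, margYZ_toReal]
  exact Finset.sum_comm

/-- Splitting the logarithm brings the sum into the shape of `condMI`, so the two can be compared
for each `(y,z)`. -/
theorem condShannonMI_eq (P : PMF (X × Y × Z)) :
    condShannonMI P = ∑ z, ∑ y, ((∑ x, (P (x, y, z)).toReal *
        Real.log ((P (x, y, z)).toReal / (margXZ P (x, z)).toReal))
      - (margYZ P (y, z)).toReal * Real.log (margYZ P (y, z)).toReal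
      + (margYZ P (y, z)).toReal * Real.log (margZ P z).toReal) := by
  have key : ∀ x y z, (P (x, y, z)).toReal *
      Real.log (((P (x, y, z)).toReal * (margZ P z).toReal) /
        ((margXZ P (x, z)).toReal * (margYZ P (y, z)).toReal))
      = (P (x, y, z)).toReal * Real.log ((P (x, y, z)).toReal / (margXZ P (x, z)).toReal)
        - (P (x, y, z)).toReal * Real.log (margYZ P (y, z)).toReal
        + (P (x, y, z)).toReal * Real.log (margZ P z).toReal := by
    intro x y z
    rcases (ENNReal.toReal_nonneg (a := P (x, y, z))).eq_or_lt with h | h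
    · simp [← h]
    · have h1 : (P (x, y, z)).toReal ≤ (margXZ P (x, z)).toReal := by
        rw [margXZ_toReal]
        exact Finset.single_le_sum (f := fun y => (P (x, y, z)).toReal)
          (fun _ _ => ENNReal.toReal_nonneg) (Finset.mem_univ y)
      have h2 : (P (x, y, z)).toReal ≤ (margYZ P (y, z)).toReal := by
        rw [margYZ_toReal]
        exact Finset.single_le_sum (f := fun x => (P (x, y, z)).toReal)
          (fun _ _ => ENNReal.toReal_nonneg) (Finset.mem_univ x)
      have h3 : (margYZ P (y, z)).toReal ≤ (margZ P z).toReal := by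
        rw [margZ_toReal]
        exact Finset.single_le_sum (f := fun y => (margYZ P (y, z)).toReal)
          (fun _ _ => ENNReal.toReal_nonneg) (Finset.mem_univ y)
      have p1 := h.trans_le h1
      have p2 := h.trans_le h2
      have p3 := p2.trans_le h3
      rw [Real.log_div (by positivity) (by positivity), Real.log_mul h.ne' p3.ne',
        Real.log_mul p1.ne' p2.ne', Real.log_div h.ne' p1.ne']
      ring
  have e : condShannonMI P = ∑ z, ∑ y, ∑ x, (P (x, y, z)).toReal *
      Real.log (((P (x, y, z)).toReal * (margZ P z).toReal) /
        ((margXZ P (x, z)).toReal * (margYZ P (y, z)).toReal)) := by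
    rw [condShannonMI, Finset.sum_comm' (t' := Finset.univ) (s' := fun _ => Finset.univ)
      (by simp)]
    simp only [Finset.sum_comm (s := (Finset.univ : Finset X))]
    exact Finset.sum_comm
  rw [e]
  refine Finset.sum_congr rfl fun z _ => Finset.sum_congr rfl fun y _ => ?_
  simp only [key]
  rw [Finset.sum_add_distrib, Finset.sum_sub_distrib, ← Finset.sum_mul, ← Finset.sum_mul,
    ← margYZ_toReal]

/-- The law of `(Y, Z)` is fixed by `P`, so only the first sum depends on the choice of `U`. -/
theorem IsMarkovExtension.condMI_eq {J : PMF (A × X × Y × Z)} {P : PMF (X × Y × Z)}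
    (h : IsMarkovExtension J P) :
    condMI (margUYZ J) = ∑ z, ∑ y, ((∑' u, (margUYZ J (u, y, z)).toReal *
        Real.log ((margUYZ J (u, y, z)).toReal / ∑ y', (margUYZ J (u, y', z)).toReal))
      - (margYZ P (y, z)).toReal * Real.log (margYZ P (y, z)).toReal
      + (margYZ P (y, z)).toReal * Real.log (margZ P z).toReal) := by
  have h1 : ∀ y z, ∑' u, (margUYZ J (u, y, z)).toReal = (margYZ P (y, z)).toReal := by
    intro y z
    rw [← h.tsum_margUYZ, ENNReal.tsum_toReal_eq fun u => PMF.apply_ne_top _ _]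
  have h2 : ∀ z, ∑' u, ∑ y, (margUYZ J (u, y, z)).toReal = (margZ P z).toReal := by
    intro z
    rw [margZ_toReal, Summable.tsum_finsetSum fun y _ => summable_left_toReal _ (y, z)]
    exact Finset.sum_congr rfl fun y _ => h1 y z
  simp only [condMI, h1, h2]

/-- This gives summability over an infinite alphabet: the bound `p` is summable even when the
entropy of `U` is infinite. -/
theorem abs_mul_log_div_le {f p : ℝ} (h0 : 0 ≤ f) (hfp : f ≤ p) : |f * Real.log (f / p)| ≤ p := by
  rcases h0.eq_or_lt with h | h
  · simpa [← h] using hfp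
  · have hp : 0 < p := h.trans_le hfp
    rw [abs_le]
    constructor
    · have h1 : Real.log (p / f) ≤ p / f - 1 := Real.log_le_sub_one_of_pos (by positivity)
      have h2 : Real.log (f / p) = -Real.log (p / f) := by rw [← Real.log_inv, inv_div]
      have h3 : f * (p / f - 1) = p - f := by field_simp
      rw [h2]
      nlinarith [mul_le_mul_of_nonneg_left h1 h0]
    · have h1 : Real.log (f / p) ≤ 0 :=
        Real.log_nonpos (by positivity) (div_le_one_of_le₀ hfp hp.le)
      nlinarith

/-- Jensen's inequality for `t log t` with weights `m x / ∑ m`. -/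
theorem sum_mul_log_div_le (m V : X → ℝ) (hm : ∀ x, 0 ≤ m x) (hV : ∀ x, 0 ≤ V x) :
    (∑ x, m x * V x) * Real.log ((∑ x, m x * V x) / ∑ x, m x)
      ≤ ∑ x, m x * (V x * Real.log (V x)) := by
  set p := ∑ x, m x with hp
  rcases (Finset.sum_nonneg fun x _ => hm x : 0 ≤ ∑ x, m x).eq_or_lt with h | h
  · have h0 : ∀ x, m x = 0 := fun x =>
      (Finset.sum_eq_zero_iff_of_nonneg fun x _ => hm x).1 h.symm x (Finset.mem_univ x)
    simp [h0]
  · rw [← hp] at h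
    have hj := Real.convexOn_mul_log.map_sum_le (t := Finset.univ) (w := fun x => m x / p)
      (p := V) (fun x _ => div_nonneg (hm x) h.le)
      (by rw [← Finset.sum_div, ← hp, div_self h.ne']) (fun x _ => hV x)
    simp only [smul_eq_mul] at hj
    have e : ∀ G : X → ℝ, ∑ x, m x / p * G x = (∑ x, m x * G x) / p := by
      intro G
      rw [Finset.sum_div]
      exact Finset.sum_congr rfl fun x _ => by ring
    rw [e, e, le_div_iff₀ h] at hj
    refine le_trans (le_of_eq ?_) hj
    field_simp

/-- Data processing: `U - (X, Z) - Y` implies `I(U; Y | Z) ≤ I(X; Y | Z)`. -/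
theorem IsMarkovExtension.condMI_le {J : PMF (A × X × Y × Z)} {P : PMF (X × Y × Z)}
    (h : IsMarkovExtension J P) : condMI (margUYZ J) ≤ condShannonMI P := by
  rw [h.condMI_eq, condShannonMI_eq]
  refine Finset.sum_le_sum fun z _ => Finset.sum_le_sum fun y _ => ?_
  gcongr ?_ - _ + _
  have hms : ∀ x, Summable fun u => (margUXZ J (u, x, z)).toReal := fun x =>
    summable_left_toReal (margUXZ J) (x, z)
  have hj : ∀ u, (margUYZ J (u, y, z)).toReal
      = ∑ x, (margUXZ J (u, x, z)).toReal * (condY P z x y).toReal := by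
    intro u
    rw [h.margUYZ_eq, ENNReal.toReal_sum fun x _ => ENNReal.mul_ne_top (PMF.apply_ne_top _ _)
      (condY_ne_top P x y z)]
    simp only [ENNReal.toReal_mul]
  have hp : ∀ u, ∑ y, (margUYZ J (u, y, z)).toReal = ∑ x, (margUXZ J (u, x, z)).toReal := by
    intro u
    rw [← ENNReal.toReal_sum fun x _ => PMF.apply_ne_top _ _,
      ← ENNReal.toReal_sum fun x _ => PMF.apply_ne_top _ _, sum_margUYZ]
  -- Jensen is applied for each `u`; the bound is linear in `P(u,x,z)`, so summing over `u` leaves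
  -- only `P(x,z)`.
  calc ∑' u, (margUYZ J (u, y, z)).toReal *
        Real.log ((margUYZ J (u, y, z)).toReal / ∑ y', (margUYZ J (u, y', z)).toReal)
      ≤ ∑' u, ∑ x, (margUXZ J (u, x, z)).toReal *
          ((condY P z x y).toReal * Real.log (condY P z x y).toReal) := by
        refine Summable.tsum_le_tsum (fun u => ?_) ?_ ?_
        · rw [hp, hj]
          exact sum_mul_log_div_le _ _ (fun _ => ENNReal.toReal_nonneg)
            fun _ => ENNReal.toReal_nonneg
        · refine (summable_sum_toReal (margUYZ J) z).of_norm_bounded fun u => ?_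
          exact abs_mul_log_div_le ENNReal.toReal_nonneg (le_sum_toReal _ y z u)
        · exact summable_sum fun x _ => (hms x).mul_right _
    _ = ∑ x, (margXZ P (x, z)).toReal *
          ((condY P z x y).toReal * Real.log (condY P z x y).toReal) := by
        rw [Summable.tsum_finsetSum fun x _ => (hms x).mul_right _]
        refine Finset.sum_congr rfl fun x _ => ?_
        rw [tsum_mul_right, ← h.tsum_margUXZ,
          ENNReal.tsum_toReal_eq fun u => PMF.apply_ne_top _ _]
    _ = _ := by
        refine Finset.sum_congr rfl fun x _ => ?_
        rw [← mul_assoc, ← ENNReal.toReal_mul, margXZ_mul_condY, condY_toReal]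

/-- The choice `U = X` gives equality in the data processing inequality. -/
theorem exists_condMI_eq (P : PMF (X × Y × Z)) (e : X ≃ A) :
    ∃ J : PMF (A × X × Y × Z), IsMarkovExtension J P ∧ condMI (margUYZ J) = condShannonMI P := by
  classical
  have hM := isMarkovExtension_kernelExtension P fun i : X × Z => PMF.pure (e i.1)
  refine ⟨_, hM, ?_⟩
  rw [hM.condMI_eq, condShannonMI_eq]
  have hj : ∀ x y z, margUYZ (kernelExtension P fun i : X × Z => PMF.pure (e i.1)) (e x, y, z)
      = P (x, y, z) := by
    intro x y z
    rw [margUYZ_apply]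
    simp only [kernelExtension_apply, PMF.pure_apply, e.injective.eq_iff, ite_mul, one_mul,
      zero_mul, Finset.sum_ite_eq, Finset.mem_univ, if_true]
  refine Finset.sum_congr rfl fun z _ => Finset.sum_congr rfl fun y _ => ?_
  rw [← e.tsum_eq, tsum_fintype]
  simp only [hj, margXZ_toReal]

end OrderOne

/-- The state in the finite-order bound may vary with `a`. Fixing a state that maximises the
order-`∞` bound beforehand allows the limit `a → ∞`. -/
theorem exists_condAlphaLeakage_top_le {A X Y Z : Type*} [Fintype X] [Fintype Y] [Fintype Z]
    {J : PMF (A × X × Y × Z)} {P : PMF (X × Y × Z)} (h : IsMarkovExtension J P) :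
    ∃ z ∈ (margZ P).support,
      condAlphaLeakage (margUYZ J) ∞ ≤ Real.log (chanSup P z).toReal := by
  classical
  obtain ⟨z₀, hz₀⟩ := (margZ P).support_nonempty
  obtain ⟨z, hz, hmax⟩ := Finset.exists_max_image
    (Finset.univ.filter fun z => z ∈ (margZ P).support)
    (fun z => Real.log (chanSup P z).toReal) ⟨z₀, Finset.mem_filter.2 ⟨Finset.mem_univ _, hz₀⟩⟩
  refine ⟨z, (Finset.mem_filter.1 hz).2, ?_⟩
  rw [condAlphaLeakage_top]
  have h2 := tendsto_order_div_sub_one.mul_const (Real.log (chanSup P z).toReal)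
  rw [one_mul] at h2
  refine le_of_tendsto_of_tendsto (tendsto_condAlphaLeakageReal_atTop (margUYZ J)) h2 ?_
  filter_upwards [eventually_gt_atTop 1] with a ha
  obtain ⟨z', hz', Q, hQ, hle⟩ := h.condAlphaLeakageReal_le ha
  refine (hle.trans (eventSibsonReal_le_chanSup hQ ha)).trans ?_
  exact mul_le_mul_of_nonneg_left (hmax z' (Finset.mem_filter.2 ⟨Finset.mem_univ _, hz'⟩))
    (div_pos (by linarith) (by linarith)).le

/-- The alphabets of `U` range over a universe unrelated to that of `X`, so `X` needs a copy there.
-/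
theorem exists_equiv_alphabet (X : Type u₁) [Finite X] :
    ∃ A : Type w, Nonempty (X ≃ A) := by
  obtain ⟨n, ⟨e⟩⟩ := Finite.exists_equiv_fin X
  exact ⟨ULift (Fin n), ⟨e.trans Equiv.ulift.symm⟩⟩

/-! ### The suprema over `U` and over input laws. -/

section MaximalLeakage

variable {X : Type u₁} {Y : Type u₂} {Z : Type u₃} [Fintype X] [Fintype Y] [Fintype Z]

theorem le_condMaxAlphaLeakage {P : PMF (X × Y × Z)} {α : ℝ≥0∞} {A : Type w}
    {J : PMF (A × X × Y × Z)} (h : IsMarkovExtension J P) :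
    ((condAlphaLeakage (margUYZ J) α : ℝ) : EReal)
      ≤ condMaxAlphaLeakage.{w, u₁, u₂, u₃} P α :=
  le_iSup_of_le A (le_iSup_of_le J (le_iSup_of_le h le_rfl))

/-- Shattering reaches its target only in the limit, so the lower bound passes through a sequence.
-/
theorem le_condMaxAlphaLeakage_of_tendsto {P : PMF (X × Y × Z)} {α : ℝ≥0∞} {A : Type w}
    {J : ℕ → PMF (A × X × Y × Z)} (h : ∀ k, IsMarkovExtension (J k) P) {l : ℝ}
    (hl : Tendsto (fun k => condAlphaLeakage (margUYZ (J k)) α) atTop (𝓝 l)) :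
    ((l : ℝ) : EReal) ≤ condMaxAlphaLeakage.{w, u₁, u₂, u₃} P α :=
  le_of_tendsto ((continuous_coe_real_ereal.tendsto l).comp hl)
    (Eventually.of_forall fun k => le_condMaxAlphaLeakage (h k))

theorem exists_shatter_alphabet (X : Type u₁) [Finite X] :
    ∃ A : Type w, Nonempty (X × ℕ ≃ A) := by
  obtain ⟨B, ⟨e⟩⟩ := exists_equiv_alphabet.{w} X
  exact ⟨B × ℕ, ⟨e.prodCongr (Equiv.refl ℕ)⟩⟩

theorem condMaxAlphaLeakage_one (P : PMF (X × Y × Z)) :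
    condMaxAlphaLeakage.{w, u₁, u₂, u₃} P 1 = ((condShannonMI P : ℝ) : EReal) := by
  apply le_antisymm
  · refine iSup_le fun A => iSup_le fun J => iSup_le fun h => ?_
    rw [condAlphaLeakage_one]
    exact EReal.coe_le_coe_iff.2 h.condMI_le
  · obtain ⟨A, ⟨e⟩⟩ := exists_equiv_alphabet.{w} X
    obtain ⟨J, hJ, he⟩ := exists_condMI_eq P e
    rw [← he, ← condAlphaLeakage_one]
    exact le_condMaxAlphaLeakage hJ

theorem condMaxAlphaLeakage_top (P : PMF (X × Y × Z)) :
    condMaxAlphaLeakage.{w, u₁, u₂, u₃} P ∞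
      = ⨆ z ∈ (margZ P).support, ((Real.log (chanSup P z).toReal : ℝ) : EReal) := by
  apply le_antisymm
  · refine iSup_le fun A => iSup_le fun J => iSup_le fun h => ?_
    obtain ⟨z, hz, hle⟩ := exists_condAlphaLeakage_top_le h
    exact le_iSup₂_of_le z hz (EReal.coe_le_coe_iff.2 hle)
  · refine iSup₂_le fun z hz => ?_
    obtain ⟨A, ⟨e⟩⟩ := exists_shatter_alphabet.{w} X
    obtain ⟨J, hJ, hl⟩ := exists_tendsto_chanSup P e hz
    exact le_condMaxAlphaLeakage_of_tendsto hJ hl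

theorem iSup_eventSibson_top (P : PMF (X × Y × Z)) {z : Z} (hz : z ∈ (margZ P).support) :
    ⨆ (Q : PMF X) (_ : AbsContCondX Q P z), ((eventSibson P z Q ∞ : ℝ) : EReal)
      = ((Real.log (chanSup P z).toReal : ℝ) : EReal) := by
  apply le_antisymm
  · refine iSup₂_le fun Q hQ => EReal.coe_le_coe_iff.2 ?_
    rw [eventSibson_top hQ]
    exact Real.log_le_log (sibsonSup_pos hQ) (sibsonSup_le P z Q)
  · obtain ⟨Q, hQ, h, -⟩ := exists_sup_eq_chanSup hz
    refine le_iSup₂_of_le Q hQ (EReal.coe_le_coe_iff.2 ?_)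
    rw [eventSibson_top hQ, h]

theorem iSup_eventArimoto_top (P : PMF (X × Y × Z)) {z : Z} (hz : z ∈ (margZ P).support) :
    ⨆ (Q : PMF X) (_ : AbsContCondX Q P z), ((eventArimoto P z Q ∞ : ℝ) : EReal)
      = ((Real.log (chanSup P z).toReal : ℝ) : EReal) := by
  apply le_antisymm
  · refine iSup₂_le fun Q hQ => EReal.coe_le_coe_iff.2 ?_
    rw [eventArimoto_top hQ]
    exact Real.log_le_log (arimotoSup_pos hQ) (arimotoSup_le P z Q)
  · obtain ⟨Q, hQ, -, h⟩ := exists_sup_eq_chanSup hz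
    refine le_iSup₂_of_le Q hQ (EReal.coe_le_coe_iff.2 ?_)
    rw [eventArimoto_top hQ, h]

/-- At finite orders the tilt matches the two suprema law by law. It has no analogue at `∞`, where
both are computed. -/
theorem iSup_eventArimoto_eq_iSup_eventSibson (P : PMF (X × Y × Z)) {z : Z}
    (hz : z ∈ (margZ P).support) {α : ℝ≥0∞} (hα : 1 < α) :
    ⨆ (Q : PMF X) (_ : AbsContCondX Q P z), ((eventArimoto P z Q α : ℝ) : EReal)
      = ⨆ (Q : PMF X) (_ : AbsContCondX Q P z), ((eventSibson P z Q α : ℝ) : EReal) := by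
  by_cases ht : α = ∞
  · subst ht
    rw [iSup_eventArimoto_top P hz, iSup_eventSibson_top P hz]
  · have ha : 0 < α.toReal := ENNReal.toReal_pos (zero_lt_one.trans hα).ne' ht
    simp only [eventArimoto, eventSibson, orderExtension, if_neg hα.ne', if_neg ht]
    apply le_antisymm
    · refine iSup₂_le fun Q hQ => ?_
      obtain ⟨Q', hQ', h⟩ := exists_sibson_eq_arimoto hQ ha
      exact le_iSup₂_of_le Q' hQ' (by rw [h])
    · refine iSup₂_le fun Q hQ => ?_
      obtain ⟨Q', hQ', h⟩ := exists_arimoto_eq_sibson hQ ha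
      exact le_iSup₂_of_le Q' hQ' (by rw [h])

theorem condMaxAlphaLeakage_eq_sibson (P : PMF (X × Y × Z)) {α : ℝ≥0∞} (hα : 1 < α) :
    condMaxAlphaLeakage.{w, u₁, u₂, u₃} P α =
      ⨆ z ∈ (margZ P).support, ⨆ (Q : PMF X) (_ : AbsContCondX Q P z),
        ((eventSibson P z Q α : ℝ) : EReal) := by
  by_cases ht : α = ∞
  · subst ht
    rw [condMaxAlphaLeakage_top]
    exact biSup_congr fun z hz => (iSup_eventSibson_top P hz).symm
  · have ha : 1 < α.toReal := by
      rw [← ENNReal.toReal_one]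
      exact (ENNReal.toReal_lt_toReal ENNReal.one_ne_top ht).2 hα
    have hS : ∀ z Q, eventSibson P z Q α = eventSibsonReal P z Q α.toReal := fun z Q => by
      rw [eventSibson, orderExtension, if_neg hα.ne', if_neg ht]
    simp only [hS]
    apply le_antisymm
    · refine iSup_le fun A => iSup_le fun J => iSup_le fun h => ?_
      obtain ⟨z, hz, Q, hQ, hle⟩ := h.condAlphaLeakageReal_le ha
      rw [condAlphaLeakage_of_lt hα ht]
      exact le_iSup₂_of_le z hz (le_iSup₂_of_le Q hQ (EReal.coe_le_coe_iff.2 hle))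
    · refine iSup₂_le fun z hz => iSup₂_le fun Q hQ => ?_
      obtain ⟨A, ⟨e⟩⟩ := exists_shatter_alphabet.{w} X
      obtain ⟨J, hJ, hl⟩ := exists_tendsto_sibson P e hQ ha
      refine le_condMaxAlphaLeakage_of_tendsto hJ ?_
      simpa only [condAlphaLeakage_of_lt hα ht] using hl

end MaximalLeakage

theorem theorem2 {X : Type u₁} {Y : Type u₂} {Z : Type u₃}
    [Fintype X] [Fintype Y] [Fintype Z] (P : PMF (X × Y × Z)) :
    -- the limits that define the quantities at orders `1` and `∞` exist
    (∀ (A : Type w) (J : PMF (A × X × Y × Z)), IsMarkovExtension J P →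
      (∃ l : ℝ, Tendsto (condAlphaLeakageReal (margUYZ J)) (𝓝[>] (1 : ℝ)) (𝓝 l)) ∧
      (∃ l : ℝ, Tendsto (condAlphaLeakageReal (margUYZ J)) atTop (𝓝 l))) ∧
    (∀ z ∈ (margZ P).support, ∀ Q : PMF X, AbsContCondX Q P z →
      (∃ l : ℝ, Tendsto (eventSibsonReal P z Q) atTop (𝓝 l)) ∧
      (∃ l : ℝ, Tendsto (eventArimotoReal P z Q) atTop (𝓝 l))) ∧
    -- orders in `(1, ∞]`
    (∀ α : ℝ≥0∞, 1 < α →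
      condMaxAlphaLeakage.{w, u₁, u₂, u₃} P α =
        (⨆ z ∈ (margZ P).support, ⨆ (Q : PMF X) (_ : AbsContCondX Q P z),
          ((eventSibson P z Q α : ℝ) : EReal)) ∧
      condMaxAlphaLeakage.{w, u₁, u₂, u₃} P α =
        (⨆ z ∈ (margZ P).support, ⨆ (Q : PMF X) (_ : AbsContCondX Q P z),
          ((eventArimoto P z Q α : ℝ) : EReal))) ∧
    -- order `1`
    condMaxAlphaLeakage.{w, u₁, u₂, u₃} P 1 = ((condShannonMI P : ℝ) : EReal) := by
  refine ⟨fun A J _ => ⟨⟨_, tendsto_condAlphaLeakageReal_one _⟩,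
      ⟨_, tendsto_condAlphaLeakageReal_atTop _⟩⟩,
    fun z _ Q hQ => ⟨⟨_, tendsto_eventSibsonReal hQ⟩, ⟨_, tendsto_eventArimotoReal hQ⟩⟩,
    fun α hα => ?_, condMaxAlphaLeakage_one P⟩
  have h := condMaxAlphaLeakage_eq_sibson.{w} P hα
  refine ⟨h, h.trans ?_⟩
  exact biSup_congr fun z hz => (iSup_eventArimoto_eq_iSup_eventSibson P hz hα).symm
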